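/- Let $d \ge 2$ and let $\xi_1, \xi_2, \dots$ be i.i.d. random vectors uniform on the unit Euclidean sphere $S^{d-1} = \{x \in \mathbb{R}^d : |x| = 1\}$, where $|\cdot|$ is the Euclidean norm. Let $L_p = L_p[0,1]$ be the space of real functions on $[0,1]$ with Lebesgue measure, and for a measurable function $F$ on $[0,1]$ with values in $\mathbb{R}$ or $\mathbb{R}^d$ write $\|F\|_p = \left(\int_0^1 |F(t)|^p \, dt\right)^{1/p}$. Let $2 \le p < \infty$. For every $n \ge 1$ and all functions $f_1, \dots, f_n \in L_p$, $$\mathbb{E}\left\|\sum_{k=1}^n \xi_k f_k\right\|_p^p \le \mathbb{E}\left|\sum_{k=1}^n \xi_k \|f_k\|_p\right|^p .$$ If $d \ge 3$ and $1 \le p \le 2$, then for every $n \ge 1$ and all $f_1, \dots, f_n \in L_p$ the reverse inequality holds: $$\mathbb{E}\left\|\sum_{k=1}^n \xi_k f_k\right\|_p^p \ge \mathbb{E}\left|\sum_{k=1}^n \xi_k \|f_k\|_p\right|^p .$$ In both cases all the expectations are finite. -/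

import Mathlib

open MeasureTheory ProbabilityTheory

/-- The uniform probability distribution on the unit Euclidean sphere of `ℝ^d` (normalised surface
measure), viewed as a measure on `ℝ^d`. It is a probability measure as soon as `d ≥ 1`. -/
noncomputable def uniformSphere (d : ℕ) : Measure (EuclideanSpace ℝ (Fin d)) :=
  Measure.map Subtype.val
    (((volume : Measure (EuclideanSpace ℝ (Fin d))).toSphere Set.univ)⁻¹ •
      (volume : Measure (EuclideanSpace ℝ (Fin d))).toSphere)

/-- The norm `‖F‖_p = (∫_0^1 |F(t)|^p dt)^{1/p}` of a function on `[0,1]` with values in a normed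
space (here `ℝ` with the absolute value, or `ℝ^d` with the Euclidean norm). -/
noncomputable def normLp {E : Type*} [NormedAddCommGroup E] (p : ℝ) (F : ℝ → E) : ℝ :=
  (∫ t in Set.Icc (0 : ℝ) 1, ‖F t‖ ^ p) ^ (1 / p)

/-- `F` belongs to `L_p` of `[0,1]` with Lebesgue measure. -/
def InLp {E : Type*} [NormedAddCommGroup E] (p : ℝ) (F : ℝ → E) : Prop :=
  MemLp F (ENNReal.ofReal p) (volume.restrict (Set.Icc (0 : ℝ) 1))

/-- The random variable `‖∑ ξ_k f_k‖_p^p`, where `ξ_k f_k` is the function `t ↦ f_k(t) ξ_k` from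
`[0,1]` to `ℝ^d`. -/
noncomputable def sumFunPow {Ω : Type*} {d n : ℕ} (ξ : ℕ → Ω → EuclideanSpace ℝ (Fin d)) (p : ℝ)
    (f : Fin n → ℝ → ℝ) (ω : Ω) : ℝ :=
  normLp p (fun t => ∑ k : Fin n, f k t • ξ k ω) ^ p

/-- The random variable `|∑ ξ_k ‖f_k‖_p|^p`. -/
noncomputable def sumNormPow {Ω : Type*} {d n : ℕ} (ξ : ℕ → Ω → EuclideanSpace ℝ (Fin d)) (p : ℝ)
    (f : Fin n → ℝ → ℝ) (ω : Ω) : ℝ :=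
  ‖∑ k : Fin n, normLp p (f k) • ξ k ω‖ ^ p

/-! Write Φ(a) = E|∑ a_k ξ_k|^p. By Fubini the expectation of the function-valued sum is ∫ Φ(f_1(t),
…, f_n(t)) dt, and by symmetry of the sphere each f_k(t) may be replaced by |f_k(t)|. For p ≥ 2 the
theorem is then Jensen's inequality for u ↦ Φ(u_1^{1/p}, …, u_n^{1/p}) on u ≥ 0, a function
homogeneous of degree one. What is needed is its tangent plane at one point A: Φ((A_k c_k)_k) ≤ ∑
m_k c_k^p with m_k = A_k ∂_kΦ(A)/p, where ∑ m_k = Φ(A) by Euler's relation (`exists_tangent_bound`).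
Taking A_k = ‖f_k‖_p and c_k = |f_k(t)|/‖f_k‖_p and integrating in t gives the result.

The tangent bound comes from following Φ along the path l ↦ (A_k min(c_k, l))_k
(`integral_rpow_le_of_le`). Only coordinates with c_k > l move. By homogeneity ∂_kΦ on the path is
l^{p-1} times its value at (A_j min(c_j/l, 1))_j, a point below A that agrees with A in coordinate
k. If ∂_kΦ increases in the other coordinates, this is at most l^{p-1} ∂_kΦ(A), and integration in l
finishes.

The monotonicity of ∂_kΦ (`partialDeriv_rpow_mono`) is potential theory. As a function of r = a_k, Φ
is a spherical mean, and the Darboux equation writes r^{d-1} ∂_kΦ as the integral over 0 < ρ < r of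
ρ^{d-1} times the mean of the Laplacian of |x|^p. That mean increases with the other coefficients
when the Laplacian is itself subharmonic. The bi-Laplacian of |x|^p is
p(p-2)(p+d-2)(p+d-4)|x|^{p-4}: for p + d ≥ 4 its sign is that of p - 2, which explains both the
reversal at p = 2 and the condition d ≥ 3. The factor σ with σ(p-2) ≥ 0 treats both cases at once.

Since |x|^p is not smooth at 0, the argument runs on (|x|² + B)^q with q = p/2 and B > 0. Scaling
changes B as well, so monotonicity in B is also required. -/

/-! ### Differentiation under the integral sign. -/

section DiffUnderIntegral

/-- Differentiation under the integral sign over a compact space. -/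
theorem hasDerivAt_integral_of_continuous {X : Type*} [TopologicalSpace X] [CompactSpace X]
    [MeasurableSpace X] [BorelSpace X] (μ : Measure X) [IsFiniteMeasure μ]
    {F F' : ℝ → X → ℝ} (hF : ∀ r, Continuous (F r))
    (hF' : Continuous (Function.uncurry F'))
    (hd : ∀ r x, HasDerivAt (fun s => F s x) (F' r x) r) (r : ℝ) :
    HasDerivAt (fun s => ∫ x, F s x ∂μ) (∫ x, F' r x ∂μ) r := by
  have hint : ∀ {G : X → ℝ}, Continuous G → Integrable G μ := fun {G} hG =>
    hG.integrable_of_hasCompactSupport (HasCompactSupport.of_compactSpace G)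
  have hF'r : Continuous (F' r) := hF'.comp (by fun_prop : Continuous fun x : X => (r, x))
  obtain ⟨M, hM⟩ := ((isCompact_closedBall r 1).prod (isCompact_univ (X := X))).bddAbove_image
    hF'.norm.continuousOn
  refine (hasDerivAt_integral_of_dominated_loc_of_deriv_le (bound := fun _ => M)
    (Metric.closedBall_mem_nhds r one_pos) (Filter.Eventually.of_forall fun s =>
      (hint (hF s)).aestronglyMeasurable) (hint (hF r)) (hint hF'r).aestronglyMeasurable
    (Filter.Eventually.of_forall fun x s hs => ?_) (integrable_const M)
    (Filter.Eventually.of_forall fun x s _ => hd s x)).2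
  exact hM ⟨(s, x), ⟨hs, Set.mem_univ _⟩, rfl⟩

end DiffUnderIntegral

/-! ### Uniform measure on the sphere and its rotation invariance. -/

section SphereMeasure

/-- The unit sphere of `ℝ^d` as a compact space. -/
abbrev UnitSphere (d : ℕ) := Metric.sphere (0 : EuclideanSpace ℝ (Fin d)) 1

/-- The uniform probability measure on the unit sphere, as a measure on the sphere itself. -/
noncomputable def sphereMeasure (d : ℕ) : Measure (UnitSphere d) :=
  ((volume : Measure (EuclideanSpace ℝ (Fin d))).toSphere Set.univ)⁻¹ •
      (volume : Measure (EuclideanSpace ℝ (Fin d))).toSphere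

theorem isProbabilityMeasure_sphereMeasure {d : ℕ} (hd : 1 ≤ d) :
    IsProbabilityMeasure (sphereMeasure d) := by
  have : Nonempty (Fin d) := ⟨⟨0, hd⟩⟩
  constructor
  rw [sphereMeasure, Measure.smul_apply, smul_eq_mul]
  refine ENNReal.inv_mul_cancel ?_ (measure_ne_top _ _)
  rw [Measure.measure_univ_ne_zero]
  exact Measure.toSphere_ne_zero _

instance (d : ℕ) : IsFiniteMeasure (sphereMeasure d) := by
  rcases Nat.eq_zero_or_pos d with rfl | h
  · refine ⟨?_⟩
    -- For d = 0 the sphere is empty, so the infinite normalising factor multiplies the zero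
    -- measure.
    have : IsEmpty (UnitSphere 0) := ⟨fun z => by
      have h1 : ‖(z : EuclideanSpace ℝ (Fin 0))‖ = 1 := by simp
      rw [Subsingleton.elim (z : EuclideanSpace ℝ (Fin 0)) 0] at h1
      simp at h1⟩
    rw [Set.univ_eq_empty_iff.2 this]
    simp
  · have := isProbabilityMeasure_sphereMeasure h
    infer_instance

/-- The action of a linear isometry on the unit sphere. -/
noncomputable def sphereMap {d : ℕ} (R : EuclideanSpace ℝ (Fin d) ≃ₗᵢ[ℝ] EuclideanSpace ℝ (Fin d))
    (z : UnitSphere d) : UnitSphere d :=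
  ⟨R z, by simp⟩

@[simp]
theorem coe_sphereMap {d : ℕ} (R : EuclideanSpace ℝ (Fin d) ≃ₗᵢ[ℝ] EuclideanSpace ℝ (Fin d))
    (z : UnitSphere d) : (sphereMap R z : EuclideanSpace ℝ (Fin d)) = R z := rfl

theorem continuous_sphereMap {d : ℕ}
    (R : EuclideanSpace ℝ (Fin d) ≃ₗᵢ[ℝ] EuclideanSpace ℝ (Fin d)) :
    Continuous (sphereMap R) :=
  (R.continuous.comp continuous_subtype_val).subtype_mk _

-- The surface measure of s is, up to a constant, the volume of the cone (0,1)·s. An isometry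
-- commutes with forming this cone and preserves volume.
open scoped Pointwise in
theorem measurePreserving_sphereMap {d : ℕ}
    (R : EuclideanSpace ℝ (Fin d) ≃ₗᵢ[ℝ] EuclideanSpace ℝ (Fin d)) :
    MeasurePreserving (sphereMap R) (sphereMeasure d) (sphereMeasure d) := by
  refine ⟨(continuous_sphereMap R).measurable, ?_⟩
  rw [sphereMeasure, Measure.map_smul]
  congr 1
  ext s hs
  rw [Measure.map_apply (continuous_sphereMap R).measurable hs,
    Measure.toSphere_apply' _ ((continuous_sphereMap R).measurable hs),
    Measure.toSphere_apply' _ hs]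
  congr 1
  have key : Set.Ioo (0 : ℝ) 1 • ((↑) '' (sphereMap R ⁻¹' s) : Set (EuclideanSpace ℝ (Fin d))) =
      R ⁻¹' (Set.Ioo (0 : ℝ) 1 • ((↑) '' s : Set (EuclideanSpace ℝ (Fin d)))) := by
    ext x
    simp only [Set.mem_smul, Set.mem_preimage, Set.mem_image]
    constructor
    · rintro ⟨a, ha, _, ⟨z, hz, rfl⟩, rfl⟩
      exact ⟨a, ha, _, ⟨_, hz, rfl⟩, by simp⟩
    · rintro ⟨a, ha, _, ⟨z, hz, rfl⟩, hx⟩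
      refine ⟨a, ha, R.symm z, ⟨sphereMap R.symm z, ?_, rfl⟩, ?_⟩
      · have : sphereMap R (sphereMap R.symm z) = z := Subtype.ext (by simp)
        simpa [this] using hz
      · apply R.injective
        simpa using hx
  rw [key]
  exact R.measurePreserving.measure_preimage_equiv (f := R.toHomeomorph.toMeasurableEquiv) _

/-- The law of `n` independent uniform points of the unit sphere. -/
noncomputable def sphereProd (n d : ℕ) : Measure (Fin n → UnitSphere d) :=
  Measure.pi fun _ => sphereMeasure d

instance (n d : ℕ) : IsFiniteMeasure (sphereProd n d) := by
  unfold sphereProd; infer_instance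

theorem isProbabilityMeasure_sphereProd (n : ℕ) {d : ℕ} (hd : 1 ≤ d) :
    IsProbabilityMeasure (sphereProd n d) := by
  have := isProbabilityMeasure_sphereMeasure hd
  unfold sphereProd; infer_instance

theorem integrable_sphereProd {n d : ℕ} {G : (Fin n → UnitSphere d) → ℝ} (hG : Continuous G) :
    Integrable G (sphereProd n d) :=
  hG.integrable_of_hasCompactSupport (HasCompactSupport.of_compactSpace G)

theorem integral_comp_sphereMap {n d : ℕ}
    (R : Fin n → EuclideanSpace ℝ (Fin d) ≃ₗᵢ[ℝ] EuclideanSpace ℝ (Fin d))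
    {G : (Fin n → UnitSphere d) → ℝ} (hG : Continuous G) :
    ∫ x, G (fun i => sphereMap (R i) (x i)) ∂sphereProd n d = ∫ x, G x ∂sphereProd n d := by
  have h := measurePreserving_pi (fun _ : Fin n => sphereMeasure d)
    (fun _ : Fin n => sphereMeasure d) (fun i => measurePreserving_sphereMap (R i))
  change MeasurePreserving _ (sphereProd n d) (sphereProd n d) at h
  conv_rhs => rw [← h.map_eq]
  rw [integral_map h.measurable.aemeasurable hG.aestronglyMeasurable]

end SphereMeasure

/-! ### Rotations in a coordinate plane. -/

section PlaneRotation

/-- The rotation by the angle `θ` in the plane of the coordinates `i` and `j`. -/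
noncomputable def planeRotation {d : ℕ} (i j : Fin d) (hij : i ≠ j) (θ : ℝ) :
    EuclideanSpace ℝ (Fin d) ≃ₗᵢ[ℝ] EuclideanSpace ℝ (Fin d) :=
  LinearIsometry.toLinearIsometryEquiv
    { toFun := fun x => x + ((Real.cos θ - 1) * x i - Real.sin θ * x j) •
          EuclideanSpace.single i (1 : ℝ) +
          (Real.sin θ * x i + (Real.cos θ - 1) * x j) • EuclideanSpace.single j (1 : ℝ)
      map_add' := fun x y => by
        simp only [PiLp.add_apply]; module
      map_smul' := fun c x => by
        simp only [PiLp.smul_apply, smul_eq_mul, RingHom.id_apply]; module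
      norm_map' := fun x => by
        rw [← sq_eq_sq₀ (norm_nonneg _) (norm_nonneg _)]
        change ‖x + ((Real.cos θ - 1) * x i - Real.sin θ * x j) •
          EuclideanSpace.single i (1 : ℝ) +
          (Real.sin θ * x i + (Real.cos θ - 1) * x j) • EuclideanSpace.single j (1 : ℝ)‖ ^ 2 = _
        rw [norm_add_sq_real, norm_add_sq_real]
        simp only [inner_add_left, inner_smul_left, inner_smul_right, norm_smul,
          EuclideanSpace.inner_single_right, PiLp.norm_single]
        simp [hij.symm]
        linear_combination (x i ^ 2 + x j ^ 2) * Real.sin_sq_add_cos_sq θ } rfl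

theorem planeRotation_apply {d : ℕ} (i j : Fin d) (hij : i ≠ j) (θ : ℝ)
    (x : EuclideanSpace ℝ (Fin d)) :
    planeRotation i j hij θ x = x + ((Real.cos θ - 1) * x i - Real.sin θ * x j) •
          EuclideanSpace.single i (1 : ℝ) +
          (Real.sin θ * x i + (Real.cos θ - 1) * x j) • EuclideanSpace.single j (1 : ℝ) := rfl

theorem planeRotation_apply_left {d : ℕ} (i j : Fin d) (hij : i ≠ j) (θ : ℝ)
    (x : EuclideanSpace ℝ (Fin d)) :
    planeRotation i j hij θ x i = Real.cos θ * x i - Real.sin θ * x j := by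
  rw [planeRotation_apply]
  simp [hij]
  ring

theorem inner_planeRotation {d : ℕ} (i j : Fin d) (hij : i ≠ j) (θ : ℝ)
    (x y : EuclideanSpace ℝ (Fin d)) :
    inner ℝ y (planeRotation i j hij θ x) = inner ℝ y x +
      ((Real.cos θ - 1) * x i - Real.sin θ * x j) * y i +
      (Real.sin θ * x i + (Real.cos θ - 1) * x j) * y j := by
  rw [planeRotation_apply]
  simp [inner_add_right, inner_smul_right, EuclideanSpace.inner_single_right]

end PlaneRotation

/-! ### Integration by parts on the sphere from rotation invariance. -/

section SphericalMeans

theorem integral_update_sphereMap {n d : ℕ} (k : Fin n)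
    (R : EuclideanSpace ℝ (Fin d) ≃ₗᵢ[ℝ] EuclideanSpace ℝ (Fin d))
    {G : (Fin n → UnitSphere d) → ℝ} (hG : Continuous G) :
    ∫ x, G (Function.update x k (sphereMap R (x k))) ∂sphereProd n d =
      ∫ x, G x ∂sphereProd n d := by
  rw [← integral_comp_sphereMap
    (Function.update (fun _ : Fin n => LinearIsometryEquiv.refl ℝ _) k R) hG]
  congr 1
  ext x
  congr 1
  ext1 i
  rcases eq_or_ne i k with rfl | h
  · simp
  · simp only [Function.update_of_ne h]
    rfl

theorem norm_add_smul_sq {d : ℕ} (y : EuclideanSpace ℝ (Fin d)) (z : UnitSphere d) (r : ℝ) :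
    ‖y + r • (z : EuclideanSpace ℝ (Fin d))‖ ^ 2 =
      ‖y‖ ^ 2 + 2 * r * inner ℝ y (z : EuclideanSpace ℝ (Fin d)) + r ^ 2 := by
  have hz : ‖(z : EuclideanSpace ℝ (Fin d))‖ = 1 := by simp
  rw [norm_add_sq_real, inner_smul_right, norm_smul, hz, mul_one, Real.norm_eq_abs, sq_abs]
  ring

theorem continuous_comp_of_nonneg {X : Type*} [TopologicalSpace X] {g : ℝ → ℝ}
    (hg : ContinuousOn g (Set.Ici 0)) {s : X → ℝ} (hs : Continuous s) (h0 : ∀ x, 0 ≤ s x) :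
    Continuous fun x => g (s x) :=
  hg.comp_continuous hs h0

theorem continuousOn_Ici_of_hasDerivAt {g g' : ℝ → ℝ} (h : ∀ s, 0 ≤ s → HasDerivAt g (g' s) s) :
    ContinuousOn g (Set.Ici 0) :=
  fun s hs => (h s hs).continuousAt.continuousWithinAt

variable {n d : ℕ} {k : Fin n} {Y : (Fin n → UnitSphere d) → EuclideanSpace ℝ (Fin d)}

/-- Infinitesimal rotation invariance in a coordinate plane. -/
theorem integral_planeRotation_deriv (hY : Continuous Y)
    (hYk : ∀ x z, Y (Function.update x k z) = Y x)
    {g₁ g₂ : ℝ → ℝ} (hg : ∀ s, 0 ≤ s → HasDerivAt g₁ (g₂ s) s)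
    (hg₂ : ContinuousOn g₂ (Set.Ici 0)) (r : ℝ) {i j : Fin d} (hij : i ≠ j) :
    ∫ x, (-((x k : EuclideanSpace ℝ (Fin d)) j * Y x j *
        g₁ (‖Y x + r • (x k : EuclideanSpace ℝ (Fin d))‖ ^ 2)) +
      (x k : EuclideanSpace ℝ (Fin d)) i * Y x j *
        ((x k : EuclideanSpace ℝ (Fin d)) i * Y x j - (x k : EuclideanSpace ℝ (Fin d)) j * Y x i) *
        (2 * r) * g₂ (‖Y x + r • (x k : EuclideanSpace ℝ (Fin d))‖ ^ 2)) ∂sphereProd n d = 0 := by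
  have hg₁ := continuousOn_Ici_of_hasDerivAt hg
  obtain ⟨c, hc⟩ : ∃ c : ℝ → (Fin n → UnitSphere d) → ℝ, ∀ θ x, c θ x =
      Real.cos θ * (x k : EuclideanSpace ℝ (Fin d)) i -
        Real.sin θ * (x k : EuclideanSpace ℝ (Fin d)) j := ⟨_, fun _ _ => rfl⟩
  obtain ⟨e, he⟩ : ∃ e : ℝ → (Fin n → UnitSphere d) → ℝ, ∀ θ x, e θ x =
      Real.sin θ * (x k : EuclideanSpace ℝ (Fin d)) i +
        Real.cos θ * (x k : EuclideanSpace ℝ (Fin d)) j := ⟨_, fun _ _ => rfl⟩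
  obtain ⟨s, hsdef⟩ : ∃ s : ℝ → (Fin n → UnitSphere d) → ℝ, ∀ θ x, s θ x =
      ‖Y x‖ ^ 2 + 2 * r * (inner ℝ (Y x) (x k : EuclideanSpace ℝ (Fin d)) +
      (c θ x - (x k : EuclideanSpace ℝ (Fin d)) i) * Y x i +
      (e θ x - (x k : EuclideanSpace ℝ (Fin d)) j) * Y x j) + r ^ 2 := ⟨_, fun _ _ => rfl⟩
  have hs : ∀ θ x, s θ x = ‖Y x + r • (sphereMap (planeRotation i j hij θ) (x k) :
      EuclideanSpace ℝ (Fin d))‖ ^ 2 := fun θ x => by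
    rw [norm_add_smul_sq, coe_sphereMap, inner_planeRotation, hsdef, hc, he]
    ring
  have hs0 : ∀ θ x, 0 ≤ s θ x := fun θ x => by rw [hs]; positivity
  have hcc : Continuous fun p : ℝ × (Fin n → UnitSphere d) => c p.1 p.2 := by
    simp only [hc]; fun_prop
  have hec : Continuous fun p : ℝ × (Fin n → UnitSphere d) => e p.1 p.2 := by
    simp only [he]; fun_prop
  have hsc : Continuous fun p : ℝ × (Fin n → UnitSphere d) => s p.1 p.2 := by
    simp only [hsdef]; fun_prop
  have hF1 := continuous_comp_of_nonneg hg₁ hsc (fun p => hs0 p.1 p.2)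
  have hF2 := continuous_comp_of_nonneg hg₂ hsc (fun p => hs0 p.1 p.2)
  -- Here c and e are the coordinates i and j of the rotated point R_θ z, and s is |Y + r R_θ z|².
  -- The mean of F θ does not depend on θ, so the mean of its derivative at θ = 0 vanishes; that
  -- derivative is the integrand of the statement.
  obtain ⟨F, hFdef⟩ : ∃ F : ℝ → (Fin n → UnitSphere d) → ℝ, ∀ θ x, F θ x =
      c θ x * Y x j * g₁ (s θ x) := ⟨_, fun _ _ => rfl⟩
  obtain ⟨F', hF'def⟩ : ∃ F : ℝ → (Fin n → UnitSphere d) → ℝ, ∀ θ x, F θ x =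
      -e θ x * Y x j * g₁ (s θ x) +
    c θ x * Y x j * (g₂ (s θ x) * (2 * r * (-e θ x * Y x i + c θ x * Y x j))) :=
    ⟨_, fun _ _ => rfl⟩
  have hFc : Continuous (Function.uncurry F) := by
    simp only [Function.uncurry_def, hFdef]
    exact (by fun_prop : Continuous fun p : ℝ × (Fin n → UnitSphere d) =>
      c p.1 p.2 * Y p.2 j).mul hF1
  have hF'c : Continuous (Function.uncurry F') := by
    simp only [Function.uncurry_def, hF'def]
    exact ((by fun_prop : Continuous fun p : ℝ × (Fin n → UnitSphere d) =>
      -e p.1 p.2 * Y p.2 j).mul hF1).add ((by fun_prop : Continuous fun p :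
      ℝ × (Fin n → UnitSphere d) => c p.1 p.2 * Y p.2 j).mul (hF2.mul (by fun_prop)))
  have hFd : ∀ θ x, HasDerivAt (fun t => F t x) (F' θ x) θ := fun θ x => by
    have hcos := Real.hasDerivAt_cos θ
    have hsin := Real.hasDerivAt_sin θ
    have hct : HasDerivAt (fun t => c t x) (-e θ x) θ := by
      simp only [hc]
      refine ((hcos.mul_const _).sub (hsin.mul_const _)).congr_deriv ?_
      rw [he]; ring
    have het : HasDerivAt (fun t => e t x) (c θ x) θ := by
      simp only [he]
      refine ((hsin.mul_const _).add (hcos.mul_const _)).congr_deriv ?_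
      rw [hc]; ring
    have hst : HasDerivAt (fun t => s t x) (2 * r * (-e θ x * Y x i + c θ x * Y x j)) θ := by
      simp only [hsdef]
      exact (((((hct.sub_const _).mul_const _).const_add _).add
        ((het.sub_const _).mul_const _)).const_mul (2 * r)).const_add _ |>.add_const _
    simp only [hFdef, hF'def]
    exact (hct.mul_const (Y x j)).mul ((hg _ (hs0 θ x)).comp θ hst)
  have hconst : ∀ θ, ∫ x, F θ x ∂sphereProd n d = ∫ x, F 0 x ∂sphereProd n d := fun θ => by
    have h0 : Continuous (F 0) := hFc.comp (by fun_prop : Continuous fun x :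
      Fin n → UnitSphere d => ((0 : ℝ), x))
    rw [← integral_update_sphereMap k (planeRotation i j hij θ) h0]
    refine integral_congr_ae (Filter.Eventually.of_forall fun x => ?_)
    have h1 : s θ x = s 0 (Function.update x k (sphereMap (planeRotation i j hij θ) (x k))) := by
      rw [hs, hsdef]
      simp only [hYk, Function.update_self, hc, he]
      simpa using norm_add_smul_sq (Y x) (sphereMap (planeRotation i j hij θ) (x k)) r
    have h2 : c θ x = c 0 (Function.update x k (sphereMap (planeRotation i j hij θ) (x k))) := by
      simp [hc, Function.update_self, planeRotation_apply_left]
    simp only [hFdef]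
    rw [← h1, ← h2, hYk]
  have hder := hasDerivAt_integral_of_continuous (sphereProd n d)
    (fun θ => hFc.comp (by fun_prop : Continuous fun x : Fin n → UnitSphere d => (θ, x)))
    hF'c hFd 0
  have hzero := hder.unique
    ((hasDerivAt_const (0 : ℝ) (∫ x, F 0 x ∂sphereProd n d)).congr_of_eventuallyEq
    (Filter.Eventually.of_forall hconst))
  rw [← hzero]
  refine integral_congr_ae (Filter.Eventually.of_forall fun x => ?_)
  have h2 : ‖Y x + r • (x k : EuclideanSpace ℝ (Fin d))‖ ^ 2 = s 0 x := by
    rw [norm_add_smul_sq, hsdef]; simp [hc, he]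
  simp only [h2, hF'def]
  simp only [he, hc, Real.cos_zero, Real.sin_zero]
  ring

/-- Integration by parts on the sphere. -/
theorem integral_inner_mul_eq (hY : Continuous Y)
    (hYk : ∀ x z, Y (Function.update x k z) = Y x)
    {g₁ g₂ : ℝ → ℝ} (hg : ∀ s, 0 ≤ s → HasDerivAt g₁ (g₂ s) s)
    (hg₂ : ContinuousOn g₂ (Set.Ici 0)) (r : ℝ) :
    ((d : ℝ) - 1) * ∫ x, inner ℝ (Y x) (x k : EuclideanSpace ℝ (Fin d)) *
        g₁ (‖Y x + r • (x k : EuclideanSpace ℝ (Fin d))‖ ^ 2) ∂sphereProd n d =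
      ∫ x, (‖Y x‖ ^ 2 - inner ℝ (Y x) (x k : EuclideanSpace ℝ (Fin d)) ^ 2) * (2 * r) *
        g₂ (‖Y x + r • (x k : EuclideanSpace ℝ (Fin d))‖ ^ 2) ∂sphereProd n d := by
  have hg₁ := continuousOn_Ici_of_hasDerivAt hg
  have hsc : Continuous fun x : Fin n → UnitSphere d =>
      ‖Y x + r • (x k : EuclideanSpace ℝ (Fin d))‖ ^ 2 := by fun_prop
  have hF1 := continuous_comp_of_nonneg hg₁ hsc (fun p => by positivity)
  have hF2 := continuous_comp_of_nonneg hg₂ hsc (fun p => by positivity)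
  obtain ⟨A, hA⟩ : ∃ A : (Fin n → UnitSphere d) → ℝ, A = fun x =>
    g₁ (‖Y x + r • (x k : EuclideanSpace ℝ (Fin d))‖ ^ 2) := ⟨_, rfl⟩
  obtain ⟨B, hB⟩ : ∃ B : (Fin n → UnitSphere d) → ℝ, B = fun x =>
    g₂ (‖Y x + r • (x k : EuclideanSpace ℝ (Fin d))‖ ^ 2) := ⟨_, rfl⟩
  have hAx : ∀ x, g₁ (‖Y x + r • (x k : EuclideanSpace ℝ (Fin d))‖ ^ 2) = A x := fun x => by
    rw [hA]
  have hBx : ∀ x, g₂ (‖Y x + r • (x k : EuclideanSpace ℝ (Fin d))‖ ^ 2) = B x := fun x => by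
    rw [hB]
  rw [← hA] at hF1
  rw [← hB] at hF2
  -- For i ≠ j the mean of G i j is zero. Summing over all pairs and removing the diagonal, which
  -- corresponds to no rotation, is what produces the factor d - 1.
  obtain ⟨G, hG⟩ : ∃ G : Fin d → Fin d → (Fin n → UnitSphere d) → ℝ, ∀ i j x, G i j x =
    (-((x k : EuclideanSpace ℝ (Fin d)) j * Y x j *
        A x) +
      (x k : EuclideanSpace ℝ (Fin d)) i * Y x j *
        ((x k : EuclideanSpace ℝ (Fin d)) i * Y x j - (x k : EuclideanSpace ℝ (Fin d)) j * Y x i) *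
        (2 * r) * B x) := ⟨_, fun _ _ _ => rfl⟩
  have hGc : ∀ i j, Continuous (G i j) := fun i j => by
    rw [funext (hG i j)]; fun_prop
  have hpair : ∀ i j, ∫ x, G i j x ∂sphereProd n d =
      if i = j then ∫ x, G i i x ∂sphereProd n d else 0 := fun i j => by
    split_ifs with h
    · rw [h]
    · rw [← integral_planeRotation_deriv hY hYk hg hg₂ r h]
      simp only [hG, hAx, hBx]
  have hsum : ∫ x, (∑ i, ∑ j, G i j x - ∑ i, G i i x) ∂sphereProd n d = 0 := by
    rw [integral_sub (integrable_sphereProd (by fun_prop)) (integrable_sphereProd (by fun_prop)),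
      integral_finsetSum _ (fun i _ => integrable_sphereProd (by fun_prop)),
      integral_finsetSum _ (fun i _ => integrable_sphereProd (by fun_prop)), sub_eq_zero]
    refine Finset.sum_congr rfl fun i _ => ?_
    rw [integral_finsetSum _ (fun j _ => integrable_sphereProd (by fun_prop))]
    rw [Finset.sum_congr rfl fun j _ => hpair i j]
    simp
  simp only [hAx, hBx]
  rw [← integral_const_mul, eq_comm, ← sub_eq_zero, ← integral_sub
    (integrable_sphereProd (by fun_prop)) (integrable_sphereProd (by fun_prop)), ← hsum]
  refine integral_congr_ae (Filter.Eventually.of_forall fun x => ?_)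
  have hz : ∑ i, (x k : EuclideanSpace ℝ (Fin d)) i ^ 2 = 1 := by
    have h1 : ‖(x k : EuclideanSpace ℝ (Fin d))‖ ^ 2 = 1 := by simp
    rw [← h1, EuclideanSpace.real_norm_sq_eq]
  have hYs : ‖Y x‖ ^ 2 = ∑ i, Y x i ^ 2 := EuclideanSpace.real_norm_sq_eq _
  have hin : inner ℝ (Y x) (x k : EuclideanSpace ℝ (Fin d)) =
      ∑ i, (x k : EuclideanSpace ℝ (Fin d)) i * Y x i := by
    simp [PiLp.inner_apply]
  have e1 : ∑ i, ∑ j, G i j x = -((d : ℝ) * (inner ℝ (Y x) (x k : EuclideanSpace ℝ (Fin d)) * A x)) +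
      ((∑ i, (x k : EuclideanSpace ℝ (Fin d)) i ^ 2) * (∑ i, Y x i ^ 2) -
        inner ℝ (Y x) (x k : EuclideanSpace ℝ (Fin d)) *
          inner ℝ (Y x) (x k : EuclideanSpace ℝ (Fin d))) * (2 * r) * B x := by
    rw [hin, Finset.sum_mul_sum, Finset.sum_mul_sum]
    simp only [Finset.sum_mul, ← Finset.sum_sub_distrib]
    simp only [hG, Finset.sum_add_distrib]
    congr 1
    · simp [Finset.sum_neg_distrib]
    · refine Finset.sum_congr rfl fun i _ => Finset.sum_congr rfl fun j _ => ?_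
      ring
  have e2 : ∑ i, G i i x = -(inner ℝ (Y x) (x k : EuclideanSpace ℝ (Fin d)) * A x) := by
    rw [hin, Finset.sum_mul, ← Finset.sum_neg_distrib]
    refine Finset.sum_congr rfl fun i _ => ?_
    simp only [hG]
    ring
  simp only [e1, e2, hz, ← hYs]
  ring

end SphericalMeans

/-! ### The Darboux equation for spherical means. -/

section Darboux

variable {n d : ℕ} {k : Fin n} {Y : (Fin n → UnitSphere d) → EuclideanSpace ℝ (Fin d)}

/-- The Darboux equation for spherical means of a radial function: if `g₁` is the derivative of a
profile `g`, then `r ^ (d - 1)` times the radial derivative of the mean of `g (‖Y + r z‖ ^ 2)` has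
as derivative `r ^ (d - 1)` times the mean of the Laplacian. -/
theorem hasDerivAt_pow_mul_radialDeriv (hd : 2 ≤ d) (hY : Continuous Y)
    (hYk : ∀ x z, Y (Function.update x k z) = Y x)
    {g₁ g₂ : ℝ → ℝ} (hg : ∀ s, 0 ≤ s → HasDerivAt g₁ (g₂ s) s)
    (hg₂ : ContinuousOn g₂ (Set.Ici 0)) (r : ℝ) :
    HasDerivAt (fun ρ : ℝ => ρ ^ (d - 1) * ∫ x,
        g₁ (‖Y x + ρ • (x k : EuclideanSpace ℝ (Fin d))‖ ^ 2) *
          (2 * (ρ + inner ℝ (Y x) (x k : EuclideanSpace ℝ (Fin d)))) ∂sphereProd n d)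
      (r ^ (d - 1) * ∫ x, (4 * ‖Y x + r • (x k : EuclideanSpace ℝ (Fin d))‖ ^ 2 *
          g₂ (‖Y x + r • (x k : EuclideanSpace ℝ (Fin d))‖ ^ 2) +
        2 * d * g₁ (‖Y x + r • (x k : EuclideanSpace ℝ (Fin d))‖ ^ 2)) ∂sphereProd n d) r := by
  have hg₁ := continuousOn_Ici_of_hasDerivAt hg
  have hstein := integral_inner_mul_eq (k := k) hY hYk hg hg₂ r
  have hsc : Continuous fun p : ℝ × (Fin n → UnitSphere d) =>
      ‖Y p.2 + p.1 • (p.2 k : EuclideanSpace ℝ (Fin d))‖ ^ 2 := by fun_prop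
  have hF1 := continuous_comp_of_nonneg hg₁ hsc (fun p => by positivity)
  have hF2 := continuous_comp_of_nonneg hg₂ hsc (fun p => by positivity)
  have hder : HasDerivAt (fun ρ : ℝ => ∫ x,
        g₁ (‖Y x + ρ • (x k : EuclideanSpace ℝ (Fin d))‖ ^ 2) *
          (2 * (ρ + inner ℝ (Y x) (x k : EuclideanSpace ℝ (Fin d)))) ∂sphereProd n d)
      (∫ x, (g₂ (‖Y x + r • (x k : EuclideanSpace ℝ (Fin d))‖ ^ 2) *
          (2 * (r + inner ℝ (Y x) (x k : EuclideanSpace ℝ (Fin d)))) *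
          (2 * (r + inner ℝ (Y x) (x k : EuclideanSpace ℝ (Fin d)))) +
        g₁ (‖Y x + r • (x k : EuclideanSpace ℝ (Fin d))‖ ^ 2) * 2) ∂sphereProd n d) r := by
    refine hasDerivAt_integral_of_continuous (sphereProd n d)
      (F := fun ρ x => g₁ (‖Y x + ρ • (x k : EuclideanSpace ℝ (Fin d))‖ ^ 2) *
          (2 * (ρ + inner ℝ (Y x) (x k : EuclideanSpace ℝ (Fin d)))))
      (F' := fun r x => g₂ (‖Y x + r • (x k : EuclideanSpace ℝ (Fin d))‖ ^ 2) *
          (2 * (r + inner ℝ (Y x) (x k : EuclideanSpace ℝ (Fin d)))) *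
          (2 * (r + inner ℝ (Y x) (x k : EuclideanSpace ℝ (Fin d)))) +
        g₁ (‖Y x + r • (x k : EuclideanSpace ℝ (Fin d))‖ ^ 2) * 2) ?_ ?_ ?_ r
    · intro ρ
      exact (hF1.comp (by fun_prop : Continuous fun x : Fin n → UnitSphere d => (ρ, x))).mul
        (by fun_prop)
    · exact ((hF2.mul (by fun_prop)).mul (by fun_prop)).add (hF1.mul continuous_const)
    · intro ρ x
      have hst : HasDerivAt (fun ρ : ℝ => ‖Y x + ρ • (x k : EuclideanSpace ℝ (Fin d))‖ ^ 2)
          (2 * (ρ + inner ℝ (Y x) (x k : EuclideanSpace ℝ (Fin d)))) ρ := by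
        simp only [norm_add_smul_sq]
        refine ((((hasDerivAt_id ρ).const_mul 2).mul_const _).const_add _ |>.add
          (hasDerivAt_pow 2 ρ)).congr_deriv ?_
        norm_num; ring
      refine (((hg _ (by positivity)).comp ρ hst).mul
        (((hasDerivAt_id ρ).add_const _).const_mul 2)).congr_deriv ?_
      simp [Function.comp]
  -- The product rule leaves (d-1) r^{d-2} times the mean of 2 g₁ (r + ⟨Y,z⟩). `hstein` turns its
  -- ⟨Y,z⟩ part into a mean of g₂ with weight |Y|² - ⟨Y,z⟩², which completes (r + ⟨Y,z⟩)² to |Y +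
  -- rz|². The remaining part raises the coefficient of g₁ from 2 to 2d.
  refine ((hasDerivAt_pow (d - 1) r).mul hder).congr_deriv ?_
  have hX : Continuous fun x : Fin n → UnitSphere d => (r, x) := by fun_prop
  obtain ⟨A, hA⟩ : ∃ A : (Fin n → UnitSphere d) → ℝ, ∀ x,
    g₁ (‖Y x + r • (x k : EuclideanSpace ℝ (Fin d))‖ ^ 2) = A x := ⟨_, fun _ => rfl⟩
  obtain ⟨B, hB⟩ : ∃ B : (Fin n → UnitSphere d) → ℝ, ∀ x,
    g₂ (‖Y x + r • (x k : EuclideanSpace ℝ (Fin d))‖ ^ 2) = B x := ⟨_, fun _ => rfl⟩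
  have hAc : Continuous A := by
    have h := hF1.comp hX
    simp only [Function.comp_def, hA] at h
    exact h
  have hBc : Continuous B := by
    have h := hF2.comp hX
    simp only [Function.comp_def, hB] at h
    exact h
  simp only [hA, hB] at hstein ⊢
  simp only [norm_add_smul_sq]
  obtain ⟨m, rfl⟩ := Nat.exists_eq_add_of_le' hd
  have e1 : m + 2 - 1 = m + 1 := rfl
  have e2 : m + 1 - 1 = m := rfl
  rw [e1, e2, pow_succ r m, mul_comm ((m + 1 : ℕ) : ℝ) (r ^ m), mul_assoc (r ^ m),
    mul_assoc (r ^ m), mul_assoc (r ^ m), ← mul_add]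
  congr 1
  push_cast at hstein ⊢
  rw [← sub_eq_zero] at hstein ⊢
  rw [← integral_const_mul, ← integral_sub (integrable_sphereProd (by fun_prop))
    (integrable_sphereProd (by fun_prop))] at hstein
  rw [← integral_const_mul, ← integral_const_mul, ← integral_const_mul,
    ← integral_add (integrable_sphereProd (by fun_prop)) (integrable_sphereProd (by fun_prop)),
    ← integral_sub (integrable_sphereProd (by fun_prop)) (integrable_sphereProd (by fun_prop))]
  refine Eq.trans ?_ ((congrArg (fun t : ℝ => 2 * t) hstein).trans (mul_zero 2))
  rw [← integral_const_mul]
  refine integral_congr_ae (Filter.Eventually.of_forall fun x => ?_)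
  simp only
  ring

/-- Comparison of radial derivatives of spherical means through the means of the Laplacians. -/
theorem radialDeriv_le_radialDeriv (hd : 2 ≤ d) (hY : Continuous Y)
    (hYk : ∀ x z, Y (Function.update x k z) = Y x)
    {Z : (Fin n → UnitSphere d) → EuclideanSpace ℝ (Fin d)} (hZ : Continuous Z)
    (hZk : ∀ x z, Z (Function.update x k z) = Z x)
    {g₁ g₂ : ℝ → ℝ} (hg : ∀ s, 0 ≤ s → HasDerivAt g₁ (g₂ s) s)
    (hg₂ : ContinuousOn g₂ (Set.Ici 0))
    {h₁ h₂ : ℝ → ℝ} (hh : ∀ s, 0 ≤ s → HasDerivAt h₁ (h₂ s) s)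
    (hh₂ : ContinuousOn h₂ (Set.Ici 0)) {r : ℝ} (hr : 0 < r)
    (hle : ∀ ρ, 0 < ρ → ρ < r →
      ∫ x, (4 * ‖Y x + ρ • (x k : EuclideanSpace ℝ (Fin d))‖ ^ 2 *
          g₂ (‖Y x + ρ • (x k : EuclideanSpace ℝ (Fin d))‖ ^ 2) +
        2 * d * g₁ (‖Y x + ρ • (x k : EuclideanSpace ℝ (Fin d))‖ ^ 2)) ∂sphereProd n d ≤
      ∫ x, (4 * ‖Z x + ρ • (x k : EuclideanSpace ℝ (Fin d))‖ ^ 2 *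
          h₂ (‖Z x + ρ • (x k : EuclideanSpace ℝ (Fin d))‖ ^ 2) +
        2 * d * h₁ (‖Z x + ρ • (x k : EuclideanSpace ℝ (Fin d))‖ ^ 2)) ∂sphereProd n d) :
    ∫ x, g₁ (‖Y x + r • (x k : EuclideanSpace ℝ (Fin d))‖ ^ 2) *
          (2 * (r + inner ℝ (Y x) (x k : EuclideanSpace ℝ (Fin d)))) ∂sphereProd n d ≤
    ∫ x, h₁ (‖Z x + r • (x k : EuclideanSpace ℝ (Fin d))‖ ^ 2) *
          (2 * (r + inner ℝ (Z x) (x k : EuclideanSpace ℝ (Fin d)))) ∂sphereProd n d := by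
  have hder := fun ρ => (hasDerivAt_pow_mul_radialDeriv (k := k) hd hZ hZk hh hh₂ ρ).sub
    (hasDerivAt_pow_mul_radialDeriv (k := k) hd hY hYk hg hg₂ ρ)
  have hmono := monotoneOn_of_deriv_nonneg (convex_Icc 0 r)
    (fun ρ _ => (hder ρ).continuousAt.continuousWithinAt)
    (fun ρ _ => (hder ρ).differentiableAt.differentiableWithinAt) (fun ρ hρ => by
      rw [interior_Icc] at hρ
      rw [(hder ρ).deriv, ← mul_sub]
      exact mul_nonneg (pow_nonneg hρ.1.le _) (sub_nonneg.2 (hle ρ hρ.1 hρ.2)))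
  have h0 := hmono (Set.left_mem_Icc.2 hr.le) (Set.right_mem_Icc.2 hr.le) hr.le
  -- The weight ρ^{d-1} vanishes at ρ = 0, so there is no initial value to compare.
  have hd1 : d - 1 ≠ 0 := by omega
  simp only [Pi.sub_apply, zero_pow hd1, zero_mul, sub_zero, ← mul_sub] at h0
  exact sub_nonneg.1 (nonneg_of_mul_nonneg_right h0 (pow_pos hr _))

end Darboux

/-! ### Means of radial functions of ∑ a_k z_k as functions of the coefficients. -/

section SphereSum

variable {n d : ℕ}

/-- The linear combination `∑ a_k z_k` of points `z_k` of the unit sphere. -/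
noncomputable def sphereSum (a : Fin n → ℝ) (x : Fin n → UnitSphere d) :
    EuclideanSpace ℝ (Fin d) :=
  ∑ j, a j • (x j : EuclideanSpace ℝ (Fin d))

theorem continuous_sphereSum :
    Continuous fun p : (Fin n → ℝ) × (Fin n → UnitSphere d) => sphereSum p.1 p.2 := by
  unfold sphereSum; fun_prop

theorem continuous_sphereSum_right (a : Fin n → ℝ) :
    Continuous fun x : Fin n → UnitSphere d => sphereSum a x := by
  unfold sphereSum; fun_prop

theorem sphereSum_add (a b : Fin n → ℝ) (x : Fin n → UnitSphere d) :
    sphereSum (a + b) x = sphereSum a x + sphereSum b x := by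
  simp [sphereSum, add_smul, Finset.sum_add_distrib]

theorem sphereSum_smul (c : ℝ) (a : Fin n → ℝ) (x : Fin n → UnitSphere d) :
    sphereSum (c • a) x = c • sphereSum a x := by
  simp [sphereSum, mul_smul, Finset.smul_sum]

theorem sphereSum_update (a : Fin n → ℝ) (k : Fin n) (r : ℝ) (x : Fin n → UnitSphere d) :
    sphereSum (Function.update a k r) x =
      sphereSum (Function.update a k 0) x + r • (x k : EuclideanSpace ℝ (Fin d)) := by
  have h : Function.update a k r = Function.update a k 0 + r • Pi.single k (1 : ℝ) := by
    ext i
    rcases eq_or_ne i k with rfl | h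
    · simp
    · simp [h]
  rw [h, sphereSum_add, sphereSum_smul]
  congr 2
  simp [sphereSum, Pi.single_apply]

theorem sphereSum_update_zero_update (a : Fin n → ℝ) (k : Fin n) (x : Fin n → UnitSphere d)
    (z : UnitSphere d) :
    sphereSum (Function.update a k 0) (Function.update x k z) =
      sphereSum (Function.update a k 0) x := by
  refine Finset.sum_congr rfl fun i _ => ?_
  rcases eq_or_ne i k with rfl | h
  · simp
  · simp [h]

theorem inner_sphereSum (b : Fin n → ℝ) (x : Fin n → UnitSphere d)
    (y : EuclideanSpace ℝ (Fin d)) :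
    inner ℝ y (sphereSum b x) = ∑ j, b j * inner ℝ y (x j : EuclideanSpace ℝ (Fin d)) := by
  simp [sphereSum, inner_sum, inner_smul_right]

/-- With every coefficient but the k-th frozen, the partial derivative in a_k is the radial
derivative of a spherical mean about Y = ∑_{j ≠ k} a_j z_j, so the Darboux comparison applies on 0 <
ρ < a_k. -/
theorem partialDeriv_le_partialDeriv (hd : 2 ≤ d)
    {g₁ g₂ : ℝ → ℝ} (hg : ∀ s, 0 ≤ s → HasDerivAt g₁ (g₂ s) s)
    (hg₂ : ContinuousOn g₂ (Set.Ici 0))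
    {h₁ h₂ : ℝ → ℝ} (hh : ∀ s, 0 ≤ s → HasDerivAt h₁ (h₂ s) s)
    (hh₂ : ContinuousOn h₂ (Set.Ici 0)) {a b : Fin n → ℝ} {k : Fin n} (hk : 0 < a k)
    (hab : a k = b k)
    (hle : ∀ ρ, 0 < ρ → ρ < a k →
      ∫ x, (4 * ‖sphereSum (Function.update a k ρ) x‖ ^ 2 *
          g₂ (‖sphereSum (Function.update a k ρ) x‖ ^ 2) +
        2 * d * g₁ (‖sphereSum (Function.update a k ρ) x‖ ^ 2)) ∂sphereProd n d ≤
      ∫ x, (4 * ‖sphereSum (Function.update b k ρ) x‖ ^ 2 *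
          h₂ (‖sphereSum (Function.update b k ρ) x‖ ^ 2) +
        2 * d * h₁ (‖sphereSum (Function.update b k ρ) x‖ ^ 2)) ∂sphereProd n d) :
    ∫ x, g₁ (‖sphereSum a x‖ ^ 2) *
        (2 * inner ℝ (sphereSum a x) (x k : EuclideanSpace ℝ (Fin d))) ∂sphereProd n d ≤
    ∫ x, h₁ (‖sphereSum b x‖ ^ 2) *
        (2 * inner ℝ (sphereSum b x) (x k : EuclideanSpace ℝ (Fin d))) ∂sphereProd n d := by
  have key := radialDeriv_le_radialDeriv (k := k) hd
    (continuous_sphereSum_right (Function.update a k 0))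
    (sphereSum_update_zero_update a k)
    (continuous_sphereSum_right (Function.update b k 0))
    (sphereSum_update_zero_update b k) hg hg₂ hh hh₂ hk
    (fun ρ h₁ h₂ => by
      simpa only [sphereSum_update a k ρ, sphereSum_update b k ρ] using hle ρ h₁ h₂)
  have e : ∀ (c : Fin n → ℝ) (x : Fin n → UnitSphere d), sphereSum c x =
      sphereSum (Function.update c k 0) x + c k • (x k : EuclideanSpace ℝ (Fin d)) := fun c x => by
    rw [← sphereSum_update, Function.update_eq_self]
  have e' : ∀ (φ : ℝ → ℝ) (c : Fin n → ℝ), ∫ x, φ (‖sphereSum c x‖ ^ 2) *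
      (2 * inner ℝ (sphereSum c x) (x k : EuclideanSpace ℝ (Fin d))) ∂sphereProd n d =
      ∫ x, φ (‖sphereSum (Function.update c k 0) x +
        c k • (x k : EuclideanSpace ℝ (Fin d))‖ ^ 2) *
      (2 * (c k + inner ℝ (sphereSum (Function.update c k 0) x)
        (x k : EuclideanSpace ℝ (Fin d)))) ∂sphereProd n d := fun φ c => by
    refine integral_congr_ae (Filter.Eventually.of_forall fun x => ?_)
    have h : inner ℝ (sphereSum c x) (x k : EuclideanSpace ℝ (Fin d)) =
        c k + inner ℝ (sphereSum (Function.update c k 0) x)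
          (x k : EuclideanSpace ℝ (Fin d)) := by
      conv_lhs => rw [e c x]
      rw [inner_add_left, inner_smul_left, real_inner_self_eq_norm_sq]
      simp [add_comm]
    simp only
    rw [h, ← e c x]
  rw [e' g₁ a, e' h₁ b, ← hab]
  exact key

/-- Derivative of a radial mean along a line in coefficient space. -/
theorem hasDerivAt_integral_sphereSum_line
    {g g₁ : ℝ → ℝ} (hg : ∀ s, 0 ≤ s → HasDerivAt g (g₁ s) s)
    (hg₁ : ContinuousOn g₁ (Set.Ici 0)) (a b : Fin n → ℝ) (t : ℝ) :
    HasDerivAt (fun t : ℝ => ∫ x, g (‖sphereSum (a + t • b) x‖ ^ 2) ∂sphereProd n d)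
      (∑ k, b k * ∫ x, g₁ (‖sphereSum (a + t • b) x‖ ^ 2) *
        (2 * inner ℝ (sphereSum (a + t • b) x) (x k : EuclideanSpace ℝ (Fin d)))
          ∂sphereProd n d) t := by
  have hg₀ := continuousOn_Ici_of_hasDerivAt hg
  have hS : Continuous fun p : ℝ × (Fin n → UnitSphere d) => sphereSum (a + p.1 • b) p.2 :=
    continuous_sphereSum.comp (by fun_prop : Continuous fun p : ℝ × (Fin n → UnitSphere d) =>
      (a + p.1 • b, p.2))
  have hF0 := continuous_comp_of_nonneg hg₀ (by fun_prop : Continuous fun p :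
    ℝ × (Fin n → UnitSphere d) => ‖sphereSum (a + p.1 • b) p.2‖ ^ 2) (fun p => by positivity)
  have hF1 := continuous_comp_of_nonneg hg₁ (by fun_prop : Continuous fun p :
    ℝ × (Fin n → UnitSphere d) => ‖sphereSum (a + p.1 • b) p.2‖ ^ 2) (fun p => by positivity)
  have hb := continuous_sphereSum_right (d := d) b
  have hX : ∀ t : ℝ, Continuous fun x : Fin n → UnitSphere d => (t, x) := fun t => by fun_prop
  have hpath : ∀ x : Fin n → UnitSphere d, ∀ t : ℝ,
      HasDerivAt (fun t : ℝ => sphereSum (a + t • b) x) (sphereSum b x) t := fun x t => by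
    simp only [sphereSum_add, sphereSum_smul]
    simpa using ((hasDerivAt_id t).smul_const (sphereSum b x)).const_add (sphereSum a x)
  have hder : HasDerivAt (fun t : ℝ => ∫ x, g (‖sphereSum (a + t • b) x‖ ^ 2) ∂sphereProd n d)
      (∫ x, g₁ (‖sphereSum (a + t • b) x‖ ^ 2) *
        (2 * inner ℝ (sphereSum (a + t • b) x) (sphereSum b x)) ∂sphereProd n d) t := by
    refine hasDerivAt_integral_of_continuous (sphereProd n d)
      (F := fun t x => g (‖sphereSum (a + t • b) x‖ ^ 2))
      (F' := fun t x => g₁ (‖sphereSum (a + t • b) x‖ ^ 2) *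
        (2 * inner ℝ (sphereSum (a + t • b) x) (sphereSum b x))) ?_ ?_ ?_ t
    · intro t
      have h := hF0.comp (hX t)
      exact h
    · have h : Continuous fun p : ℝ × (Fin n → UnitSphere d) =>
          2 * inner ℝ (sphereSum (a + p.1 • b) p.2) (sphereSum b p.2) :=
        continuous_const.mul (hS.inner (hb.comp continuous_snd))
      have h' := hF1.mul h
      exact h'
    · intro t x
      exact (hg _ (by positivity)).comp t (hpath x t).norm_sq
  refine hder.congr_deriv ?_
  simp only [← integral_const_mul]
  rw [← integral_finsetSum]
  · refine integral_congr_ae (Filter.Eventually.of_forall fun x => ?_)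
    simp only [inner_sphereSum, Finset.mul_sum]
    exact Finset.sum_congr rfl fun i _ => by ring
  · intro i _
    have h1 := hF1.comp (hX t)
    have h2 : Continuous fun x : Fin n → UnitSphere d => sphereSum (a + t • b) x :=
      hS.comp (hX t)
    exact integrable_sphereProd (continuous_const.mul (h1.mul (by fun_prop)))

/-- A radial mean of a subharmonic profile is monotone in the nonnegative coefficients. -/
theorem integral_sphereSum_mono (hd : 2 ≤ d)
    {g g₁ g₂ : ℝ → ℝ} (hg : ∀ s, 0 ≤ s → HasDerivAt g (g₁ s) s)
    (hg₁ : ∀ s, 0 ≤ s → HasDerivAt g₁ (g₂ s) s) (hg₂ : ContinuousOn g₂ (Set.Ici 0))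
    (hL : ∀ s, 0 ≤ s → 0 ≤ 4 * s * g₂ s + 2 * d * g₁ s)
    {a b : Fin n → ℝ} (ha : ∀ k, 0 ≤ a k) (hab : ∀ k, a k ≤ b k) :
    ∫ x, g (‖sphereSum a x‖ ^ 2) ∂sphereProd n d ≤
      ∫ x, g (‖sphereSum b x‖ ^ 2) ∂sphereProd n d := by
  have hder := hasDerivAt_integral_sphereSum_line (d := d) hg (continuousOn_Ici_of_hasDerivAt hg₁)
    a (b - a)
  have hmono := monotoneOn_of_deriv_nonneg (convex_Icc 0 1)
    (fun ρ _ => (hder ρ).continuousAt.continuousWithinAt)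
    (fun ρ _ => (hder ρ).differentiableAt.differentiableWithinAt) (fun t ht => by
      rw [interior_Icc] at ht
      rw [(hder t).deriv]
      refine Finset.sum_nonneg fun k _ => ?_
      rcases (hab k).eq_or_lt with h | h
      · simp [h]
      have hk : 0 < (a + t • (b - a)) k := by
        have := mul_pos ht.1 (sub_pos.2 h)
        simp only [Pi.add_apply, Pi.smul_apply, Pi.sub_apply, smul_eq_mul]
        linarith [ha k]
      refine mul_nonneg (sub_nonneg.2 h.le) ?_
      -- Comparison with the zero profile: a nonnegative Laplacian gives a nonnegative partial
      -- derivative.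
      have := partialDeriv_le_partialDeriv hd (g₁ := fun _ => 0) (g₂ := fun _ => 0)
        (fun s _ => hasDerivAt_const s 0) continuousOn_const hg₁ hg₂ hk rfl (fun ρ _ _ => by
          simp only [mul_zero, add_zero, integral_zero]
          exact integral_nonneg fun x => hL _ (by positivity))
      simpa using this)
  simpa using hmono (Set.left_mem_Icc.2 zero_le_one) (Set.right_mem_Icc.2 zero_le_one) zero_le_one

end SphereSum

/-! ### Signs of the Laplacian and bi-Laplacian of (|x|² + B)^q. -/

section PowerProfile

theorem hasDerivAt_add_rpow {s B : ℝ} (h : 0 < s + B) (m : ℝ) :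
    HasDerivAt (fun s : ℝ => (s + B) ^ m) (m * (s + B) ^ (m - 1)) s := by
  simpa using ((hasDerivAt_id s).add_const B).rpow_const (p := m) (Or.inl h.ne')

variable {n d : ℕ}

/-- The radial profile of the Laplacian of `x ↦ (‖x‖ ^ 2 + B) ^ q` increases with `B` (up to the
sign of `q - 1`). -/
theorem laplacian_rpow_profile_mono {q σ : ℝ} (hq : 0 < q) (hσ : 0 ≤ σ * (q - 1))
    (hA : 0 ≤ 2 * q + d - 4) {B' B : ℝ} (hB' : 0 < B') (hBB : B' ≤ B) {s : ℝ} (hs : 0 ≤ s) :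
    4 * s * (σ * q * (q - 1) * (s + B') ^ (q - 2)) + 2 * d * (σ * q * (s + B') ^ (q - 1)) ≤
      4 * s * (σ * q * (q - 1) * (s + B) ^ (q - 2)) + 2 * d * (σ * q * (s + B) ^ (q - 1)) := by
  have hder : ∀ b, 0 < b → HasDerivAt (fun b : ℝ => 4 * s * (σ * q * (q - 1) * (b + s) ^ (q - 2)) +
      2 * d * (σ * q * (b + s) ^ (q - 1)))
      (4 * s * (σ * q * (q - 1) * ((q - 2) * (b + s) ^ (q - 2 - 1))) +
      2 * d * (σ * q * ((q - 1) * (b + s) ^ (q - 1 - 1)))) b := fun b hb =>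
    (((hasDerivAt_add_rpow (by linarith) _).const_mul _).const_mul _).add
      (((hasDerivAt_add_rpow (by linarith) _).const_mul _).const_mul _)
  have hpos : ∀ b ∈ Set.Icc B' B, 0 < b := fun b hb => hB'.trans_le hb.1
  have hmono := monotoneOn_of_deriv_nonneg (convex_Icc B' B)
    (fun b hb => (hder b (hpos b hb)).continuousAt.continuousWithinAt)
    (fun b hb => (hder b (hpos b (interior_subset hb))).differentiableAt.differentiableWithinAt)
    (fun b hb => by
      have hb0 := hpos b (interior_subset hb)
      rw [(hder b hb0).deriv]
      have hw : 0 < b + s := by linarith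
      have e1 : (b + s) ^ (q - 1 - 1) = (b + s) ^ (q - 2 - 1) * (b + s) := by
        rw [← Real.rpow_add_one hw.ne']; congr 1; ring
      rw [e1]
      have h : 0 ≤ (σ * (q - 1)) * (q * (b + s) ^ (q - 2 - 1) *
          (2 * ((2 * q + d - 4) * s) + 2 * d * b)) := by positivity
      linarith)
  have h := hmono (Set.left_mem_Icc.2 hBB) (Set.right_mem_Icc.2 hBB) hBB
  simpa only [add_comm s] using h

theorem continuousOn_add_rpow {B : ℝ} (hB : 0 < B) (m : ℝ) :
    ContinuousOn (fun s : ℝ => (s + B) ^ m) (Set.Ici 0) :=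
  fun _ hs => (hasDerivAt_add_rpow (add_pos_of_nonneg_of_pos hs hB) m).continuousAt.continuousWithinAt

/-- The mean of the Laplacian of `x ↦ (‖x‖ ^ 2 + B) ^ q` is monotone in the coefficients (up to the
sign of `q - 1`). -/
theorem integral_laplacian_rpow_mono (hd : 2 ≤ d) {q σ : ℝ} (hq : 0 < q) (hσ : 0 ≤ σ * (q - 1))
    (hA : 0 ≤ 2 * q + d - 4) {B : ℝ} (hB : 0 < B)
    {a b : Fin n → ℝ} (ha : ∀ k, 0 ≤ a k) (hab : ∀ k, a k ≤ b k) :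
    ∫ x, (4 * ‖sphereSum a x‖ ^ 2 * (σ * q * (q - 1) * (‖sphereSum a x‖ ^ 2 + B) ^ (q - 2)) +
        2 * d * (σ * q * (‖sphereSum a x‖ ^ 2 + B) ^ (q - 1))) ∂sphereProd n d ≤
      ∫ x, (4 * ‖sphereSum b x‖ ^ 2 * (σ * q * (q - 1) * (‖sphereSum b x‖ ^ 2 + B) ^ (q - 2)) +
        2 * d * (σ * q * (‖sphereSum b x‖ ^ 2 + B) ^ (q - 1))) ∂sphereProd n d := by
  have hpos : ∀ s, 0 ≤ s → 0 < s + B := fun s hs => by linarith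
  have hc := continuousOn_add_rpow hB
  -- The subharmonic profile is the Laplacian itself, so the last condition to check is the sign of
  -- the bi-Laplacian.
  refine integral_sphereSum_mono hd
    (g := fun s => 4 * s * (σ * q * (q - 1) * (s + B) ^ (q - 2)) +
      2 * d * (σ * q * (s + B) ^ (q - 1)))
    (g₁ := fun s => (4 + 2 * d) * (σ * q * (q - 1)) * (s + B) ^ (q - 2) +
      4 * (σ * q * (q - 1) * (q - 2)) * (s * (s + B) ^ (q - 3)))
    (g₂ := fun s => (8 + 2 * d) * (σ * q * (q - 1) * (q - 2)) * (s + B) ^ (q - 3) +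
      4 * (σ * q * (q - 1) * (q - 2) * (q - 3)) * (s * (s + B) ^ (q - 4)))
    (fun s hs => ?_) (fun s hs => ?_) ?_ (fun s hs => ?_) ha hab
  · have h2 := hasDerivAt_add_rpow (hpos s hs) (q - 2)
    have h1 := hasDerivAt_add_rpow (hpos s hs) (q - 1)
    refine ((((hasDerivAt_id s).const_mul 4).mul (h2.const_mul (σ * q * (q - 1)))).add
      ((h1.const_mul (σ * q)).const_mul (2 * (d : ℝ)))).congr_deriv ?_
    rw [show q - 1 - 1 = q - 2 by ring, show q - 2 - 1 = q - 3 by ring]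
    simp only [id]
    ring
  · have h2 := hasDerivAt_add_rpow (hpos s hs) (q - 2)
    have h3 := hasDerivAt_add_rpow (hpos s hs) (q - 3)
    refine ((h2.const_mul _).add (((hasDerivAt_id s).mul h3).const_mul _)).congr_deriv ?_
    rw [show q - 3 - 1 = q - 4 by ring, show q - 2 - 1 = q - 3 by ring]
    simp only [id]
    ring
  · exact (continuousOn_const.mul (hc _)).add (continuousOn_const.mul (continuousOn_id.mul (hc _)))
  · have hw := hpos s hs
    have e3 : (s + B) ^ (q - 3) = (s + B) ^ (q - 4) * (s + B) := by
      rw [← Real.rpow_add_one hw.ne']; congr 1; ring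
    have e2 : (s + B) ^ (q - 2) = (s + B) ^ (q - 4) * (s + B) * (s + B) := by
      rw [← e3, ← Real.rpow_add_one hw.ne']; congr 1; ring
    rw [e2, e3]
    -- The bi-Laplacian in factored form. With K = 2q + d - 4 ≥ 0, every coefficient of the
    -- quadratic form in (s, B) is nonnegative.
    have h : 0 ≤ (σ * (q - 1)) * (q * (s + B) ^ (q - 4) *
        (4 * ((2 * q + d - 4) * ((2 * q + d - 4) + 2) * s ^ 2 +
          2 * (2 * q + d - 4) * (d + 2) * s * B + d * (d + 2) * B ^ 2))) := by positivity
    linarith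

/-- Up to the sign of `q - 1`, the partial derivatives of the mean of
`(‖∑ a_k z_k‖ ^ 2 + B) ^ q` increase with `B` and with the other coefficients. -/
theorem partialDeriv_rpow_mono (hd : 2 ≤ d) {q σ : ℝ} (hq : 0 < q) (hσ : 0 ≤ σ * (q - 1))
    (hA : 0 ≤ 2 * q + d - 4) {B' B : ℝ} (hB' : 0 < B') (hBB : B' ≤ B)
    {a b : Fin n → ℝ} (ha : ∀ k, 0 ≤ a k) (hab : ∀ k, a k ≤ b k) {k : Fin n} (hk : a k = b k)
    (hk0 : 0 < b k) :
    σ * ∫ x, q * (‖sphereSum a x‖ ^ 2 + B') ^ (q - 1) *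
        (2 * inner ℝ (sphereSum a x) (x k : EuclideanSpace ℝ (Fin d))) ∂sphereProd n d ≤
    σ * ∫ x, q * (‖sphereSum b x‖ ^ 2 + B) ^ (q - 1) *
        (2 * inner ℝ (sphereSum b x) (x k : EuclideanSpace ℝ (Fin d))) ∂sphereProd n d := by
  have hB : 0 < B := hB'.trans_le hBB
  have hg : ∀ B : ℝ, 0 < B → ∀ s : ℝ, 0 ≤ s → HasDerivAt (fun s => σ * q * (s + B) ^ (q - 1))
      (σ * q * (q - 1) * (s + B) ^ (q - 2)) s := fun B hB s hs => by
    refine ((hasDerivAt_add_rpow (by linarith) (q - 1)).const_mul (σ * q)).congr_deriv ?_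
    rw [show q - 1 - 1 = q - 2 by ring]
    ring
  have hc := fun (B : ℝ) (hB : 0 < B) => (continuousOn_const (c := σ * q * (q - 1))).mul
    (continuousOn_add_rpow hB (q - 2))
  have key := partialDeriv_le_partialDeriv (d := d) hd (hg B' hB') (hc B' hB') (hg B hB) (hc B hB)
    (hk ▸ hk0) hk (fun ρ h₀ _ => by
      -- Raise B' to B pointwise at the same coefficients, then raise the coefficients at fixed B.
      refine le_trans (integral_mono ?_ ?_ fun x =>
        laplacian_rpow_profile_mono hq hσ hA hB' hBB (sq_nonneg _))
        (integral_laplacian_rpow_mono hd hq hσ hA hB ?_ ?_)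
      · have hS := continuous_sphereSum_right (d := d) (Function.update a k ρ)
        have h1 := continuous_comp_of_nonneg (continuousOn_add_rpow hB' (q - 2))
          (hS.norm.pow 2) (fun x => sq_nonneg _)
        have h2 := continuous_comp_of_nonneg (continuousOn_add_rpow hB' (q - 1))
          (hS.norm.pow 2) (fun x => sq_nonneg _)
        exact integrable_sphereProd (((continuous_const.mul (hS.norm.pow 2)).mul
          (continuous_const.mul h1)).add (continuous_const.mul (continuous_const.mul h2)))
      · have hS := continuous_sphereSum_right (d := d) (Function.update a k ρ)
        have h1 := continuous_comp_of_nonneg (continuousOn_add_rpow hB (q - 2))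
          (hS.norm.pow 2) (fun x => sq_nonneg _)
        have h2 := continuous_comp_of_nonneg (continuousOn_add_rpow hB (q - 1))
          (hS.norm.pow 2) (fun x => sq_nonneg _)
        exact integrable_sphereProd (((continuous_const.mul (hS.norm.pow 2)).mul
          (continuous_const.mul h1)).add (continuous_const.mul (continuous_const.mul h2)))
      · intro j
        rcases eq_or_ne j k with rfl | h
        · simpa using h₀.le
        · simpa [h] using ha j
      · intro j
        rcases eq_or_ne j k with rfl | h
        · simp
        · simpa [h] using hab j)
  simpa only [← integral_const_mul, mul_assoc] using key

end PowerProfile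

/-! ### The tangent bound, along the truncation path. -/

section TangentBound

open Filter Topology

variable {n d : ℕ}

theorem continuous_integral_sphereSum_rpow {q : ℝ} (hq : 0 ≤ q) :
    Continuous fun p : ℝ × (Fin n → ℝ) =>
      ∫ x, (‖sphereSum p.2 x‖ ^ 2 + p.1 ^ 2) ^ q ∂sphereProd n d := by
  have h : Continuous fun p : (ℝ × (Fin n → ℝ)) × (Fin n → UnitSphere d) =>
      (‖sphereSum p.1.2 p.2‖ ^ 2 + p.1.1 ^ 2) ^ q := by
    have hS : Continuous fun p : (ℝ × (Fin n → ℝ)) × (Fin n → UnitSphere d) =>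
        sphereSum p.1.2 p.2 := continuous_sphereSum.comp (by fun_prop :
          Continuous fun p : (ℝ × (Fin n → ℝ)) × (Fin n → UnitSphere d) => (p.1.2, p.2))
    exact ((hS.norm.pow 2).add (by fun_prop)).rpow_const fun _ => Or.inr hq
  simpa using continuous_parametric_integral_of_continuous (μ := sphereProd n d)
    (f := fun (p : ℝ × (Fin n → ℝ)) (x : Fin n → UnitSphere d) =>
      (‖sphereSum p.2 x‖ ^ 2 + p.1 ^ 2) ^ q) h isCompact_univ

/-- Homogeneity of degree 2q - 1 survives smoothing if B is scaled by l² along with the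
coefficients. -/
theorem partialDeriv_rpow_smul {q B l : ℝ} (hB : 0 < B) (hl : 0 < l) (a : Fin n → ℝ) (k : Fin n) :
    ∫ x, q * (‖sphereSum (l • a) x‖ ^ 2 + l ^ 2 * B) ^ (q - 1) *
        (2 * inner ℝ (sphereSum (l • a) x) (x k : EuclideanSpace ℝ (Fin d))) ∂sphereProd n d =
      l ^ (2 * q - 1) * ∫ x, q * (‖sphereSum a x‖ ^ 2 + B) ^ (q - 1) *
        (2 * inner ℝ (sphereSum a x) (x k : EuclideanSpace ℝ (Fin d))) ∂sphereProd n d := by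
  rw [← integral_const_mul]
  refine integral_congr_ae (Eventually.of_forall fun x => ?_)
  simp only [sphereSum_smul, norm_smul, inner_smul_left, mul_pow, Real.norm_eq_abs, sq_abs,
    ← mul_add]
  rw [Real.mul_rpow (by positivity) (by positivity), ← Real.rpow_natCast, ← Real.rpow_mul hl.le,
    show (2 * q - 1) = ((2 : ℕ) : ℝ) * (q - 1) + 1 by push_cast; ring, Real.rpow_add_one hl.ne']
  simp
  ring

/-- Truncation has a kink at l = c, so it is affine only on a right neighbourhood; this is why the
growth estimate uses right derivatives. -/
theorem eventually_min_eq_add_mul (c l : ℝ) :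
    ∀ᶠ u in 𝓝[Set.Ici l] l, min c u = min c l + (u - l) * if l < c then 1 else 0 := by
  split_ifs with h
  · filter_upwards [nhdsWithin_le_nhds (Iio_mem_nhds h)] with u hu
    rw [min_eq_right (le_of_lt hu), min_eq_right h.le]
    ring
  · filter_upwards [self_mem_nhdsWithin] with u hu
    rw [min_eq_left ((not_lt.1 h).trans hu), min_eq_left (not_lt.1 h)]
    ring

/-- Growth of the mean along the truncation path `l ↦ (A_k * min (c_k) l)_k`. -/
theorem integral_rpow_le_of_le (hd : 2 ≤ d) {q σ : ℝ} (hq : 0 < q) (hσ : 0 ≤ σ * (q - 1))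
    (hA : 0 ≤ 2 * q + d - 4) {e δ : ℝ} (he : 0 < e) (hδ : 0 < δ) {A c : Fin n → ℝ}
    (hA0 : ∀ k, 0 ≤ A k) (hc : ∀ k, δ ≤ c k) :
    σ * ∫ x, (‖sphereSum (fun k => A k * c k) x‖ ^ 2 + (δ * e) ^ 2) ^ q ∂sphereProd n d ≤
      σ * ∫ x, (‖sphereSum (fun k => A k * δ) x‖ ^ 2 + (δ * e) ^ 2) ^ q ∂sphereProd n d +
      ∑ k, A k * (σ * ∫ x, q * (‖sphereSum A x‖ ^ 2 + e ^ 2) ^ (q - 1) *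
        (2 * inner ℝ (sphereSum A x) (x k : EuclideanSpace ℝ (Fin d))) ∂sphereProd n d) / (2 * q) *
        (c k ^ (2 * q) - δ ^ (2 * q)) := by
  obtain ⟨M, hM⟩ : ∃ M : Fin n → ℝ, ∀ k, M k = σ * ∫ x, q *
    (‖sphereSum A x‖ ^ 2 + e ^ 2) ^ (q - 1) *
    (2 * inner ℝ (sphereSum A x) (x k : EuclideanSpace ℝ (Fin d))) ∂sphereProd n d :=
    ⟨_, fun _ => rfl⟩
  simp only [← hM]
  obtain ⟨L, hL⟩ := (Set.finite_range c).bddAbove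
  have hcL : ∀ k, c k ≤ max L δ := fun k => (hL ⟨k, rfl⟩).trans (le_max_left _ _)
  obtain ⟨a, ha⟩ : ∃ a : ℝ → Fin n → ℝ, ∀ l, a l = fun k => A k * min (c k) l := ⟨_, fun _ => rfl⟩
  obtain ⟨β, hβ⟩ : ∃ β : ℝ → Fin n → ℝ, ∀ l, β l = fun k => A k * if l < c k then 1 else 0 :=
    ⟨_, fun _ => rfl⟩
  have haL : a (max L δ) = fun k => A k * c k := by
    rw [ha]; ext k; rw [min_eq_left (hcL k)]
  have haδ : a δ = fun k => A k * δ := by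
    rw [ha]; ext k; rw [min_eq_right (hc k)]
  have hacont : Continuous a := by
    rw [funext ha]; fun_prop
  have hde : 0 < (δ * e) ^ 2 := by positivity
  have hgd : ∀ s : ℝ, 0 ≤ s → HasDerivAt (fun s => (s + (δ * e) ^ 2) ^ q)
      (q * (s + (δ * e) ^ 2) ^ (q - 1)) s := fun s hs => hasDerivAt_add_rpow (by linarith) q
  have hgc := (continuousOn_const (c := q)).mul (continuousOn_add_rpow hde (q - 1))
  obtain ⟨F, hF⟩ : ∃ F : ℝ → (Fin n → ℝ) → ℝ, ∀ e a,
       F e a = ∫ x, (‖sphereSum a x‖ ^ 2 + e ^ 2) ^ q ∂sphereProd n d := ⟨_, fun _ _ => rfl⟩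
  have hFc : Continuous fun p : ℝ × (Fin n → ℝ) => F p.1 p.2 := by
    simp only [hF]
    exact continuous_integral_sphereSum_rpow hq.le
  simp only [← hF]
  have key := image_le_of_deriv_right_le_deriv_boundary (a := δ) (b := max L δ)
    (f := fun l => σ * F (δ * e) (a l))
    (f' := fun l => σ * ∑ k, β l k * ∫ x, q * (‖sphereSum (a l) x‖ ^ 2 + (δ * e) ^ 2) ^ (q - 1) *
        (2 * inner ℝ (sphereSum (a l) x) (x k : EuclideanSpace ℝ (Fin d))) ∂sphereProd n d)
    (B := fun l => σ * F (δ * e) (a δ) +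
      ∑ k, A k * M k / (2 * q) * (min (c k) l ^ (2 * q) - δ ^ (2 * q)))
    (B' := fun l => ∑ k, A k * M k / (2 * q) *
      ((if l < c k then 1 else 0) * (2 * q) * l ^ (2 * q - 1))) ?_ ?_ ?_ ?_ ?_ ?_
    (Set.right_mem_Icc.2 (le_max_right L δ))
  · simpa only [haL, haδ, min_eq_left (hcL _)] using key
  · refine (continuous_const.mul ?_).continuousOn
    exact hFc.comp (by fun_prop : Continuous fun l => (δ * e, a l))
  · intro l hl
    refine HasDerivWithinAt.const_mul σ ?_
    simp only [hF]
    have hline := hasDerivAt_integral_sphereSum_line (d := d) hgd hgc (a l - l • β l) (β l) l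
    rw [sub_add_cancel] at hline
    refine hline.hasDerivWithinAt.congr_of_eventuallyEq ?_ ?_
    · have h1 : ∀ᶠ u in 𝓝[Set.Ici l] l, ∀ k, min (c k) u = min (c k) l + (u - l) *
          if l < c k then 1 else 0 := eventually_all.2 fun k => eventually_min_eq_add_mul (c k) l
      filter_upwards [h1] with u hu
      have : a u = a l - l • β l + u • β l := by
        ext k
        simp only [ha, hβ, Pi.add_apply, Pi.sub_apply, Pi.smul_apply, smul_eq_mul, hu k]
        ring
      rw [this]
    · simp only [sub_add_cancel]
  · rw [haδ]
    simp [min_eq_right (hc _)]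
  · refine (continuous_const.add (continuous_finsetSum _ fun k _ =>
      continuous_const.mul (Continuous.sub ?_ continuous_const))).continuousOn
    exact (by fun_prop : Continuous fun l => min (c k) l).rpow_const
      fun _ => Or.inr (by positivity)
  · intro l hl
    have hl0 : 0 < l := hδ.trans_le hl.1
    refine HasDerivWithinAt.const_add _ (HasDerivWithinAt.fun_sum fun k _ =>
      HasDerivWithinAt.const_mul _ (HasDerivWithinAt.sub_const _ ?_))
    have hmin : HasDerivWithinAt (fun u => min (c k) u) (if l < c k then 1 else 0) (Set.Ici l) l := by
      refine HasDerivWithinAt.congr_of_eventuallyEq (f := fun u => min (c k) l + (u - l) *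
          if l < c k then 1 else 0) ?_ (eventually_min_eq_add_mul (c k) l) (by simp)
      simpa using ((((hasDerivAt_id l).sub_const l).mul_const
        (if l < c k then (1 : ℝ) else 0)).const_add (min (c k) l)).hasDerivWithinAt
    have hm0 : 0 < min (c k) l := lt_min (hδ.trans_le (hc k)) hl0
    refine (hmin.rpow_const (p := 2 * q) (Or.inl hm0.ne')).congr_deriv ?_
    split_ifs with h
    · rw [min_eq_right h.le]
    · simp
  · intro l hl
    have hl0 : 0 < l := hδ.trans_le hl.1
    simp only [Finset.mul_sum]
    refine Finset.sum_le_sum fun k _ => ?_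
    simp only [hβ]
    split_ifs with h
    swap
    · simp
    rcases (hA0 k).eq_or_lt with hk | hk
    · simp [← hk]
    have hb : a l = l • (l⁻¹ • a l) := by rw [smul_smul, mul_inv_cancel₀ hl0.ne', one_smul]
    have hB : (δ * e) ^ 2 = l ^ 2 * (δ * e / l) ^ 2 := by field_simp
    have hbk : (l⁻¹ • a l) k = A k := by
      simp only [ha, Pi.smul_apply, smul_eq_mul, min_eq_right h.le]
      field_simp
    -- After division by l the coefficients lie below A, with equality at k because l < c_k. The
    -- rescaled smoothing (δe/l)² is at most e² because the path starts at l = δ.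
    have hmono := partialDeriv_rpow_mono (a := l⁻¹ • a l) (b := A) (B' := (δ * e / l) ^ 2)
      (B := e ^ 2) hd hq hσ hA (by positivity)
      (by
        gcongr
        rw [div_le_iff₀ hl0, mul_comm]
        exact mul_le_mul_of_nonneg_left hl.1 he.le)
      (fun j => by
        simp only [ha, Pi.smul_apply, smul_eq_mul]
        have := hA0 j
        have : 0 ≤ min (c j) l := le_min (hδ.le.trans (hc j)) hl0.le
        positivity)
      (fun j => by
        simp only [ha, Pi.smul_apply, smul_eq_mul]
        rw [inv_mul_le_iff₀ hl0, mul_comm l]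
        exact mul_le_mul_of_nonneg_left (min_le_right _ _) (hA0 j)) hbk hk
    rw [hb, hB, partialDeriv_rpow_smul (by positivity) hl0]
    rw [← hM] at hmono
    have hpow : 0 ≤ l ^ (2 * q - 1) := by positivity
    have := mul_le_mul_of_nonneg_left hmono (mul_nonneg hk.le hpow)
    calc _ = _ := by ring
      _ ≤ _ := this
      _ = _ := by field_simp

/-- Tangent bound at the coefficient vector `A`, for the smoothing parameter `e`. -/
theorem exists_tangent_bound (hd : 2 ≤ d) {q σ : ℝ} (hq : 0 < q) (hσ : 0 ≤ σ * (q - 1))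
    (hA : 0 ≤ 2 * q + d - 4) {e : ℝ} (he : 0 < e) {A : Fin n → ℝ} (hA0 : ∀ k, 0 ≤ A k) :
    ∃ m : Fin n → ℝ, (∀ k, A k = 0 → m k = 0) ∧
      ∑ k, m k = σ * ∫ x, (‖sphereSum A x‖ ^ 2 + e ^ 2) ^ (q - 1) * ‖sphereSum A x‖ ^ 2
        ∂sphereProd n d ∧
      ∀ c : Fin n → ℝ, (∀ k, 0 ≤ c k) →
        σ * ∫ x, (‖sphereSum (fun k => A k * c k) x‖ ^ 2) ^ q ∂sphereProd n d ≤
          ∑ k, m k * c k ^ (2 * q) := by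
  -- The weight m_k is A_k ∂_k/(2q) of σ times the smoothed mean at A.
  refine ⟨fun k => A k * (σ * ∫ x, q * (‖sphereSum A x‖ ^ 2 + e ^ 2) ^ (q - 1) *
        (2 * inner ℝ (sphereSum A x) (x k : EuclideanSpace ℝ (Fin d))) ∂sphereProd n d) / (2 * q),
    fun k hk => by simp [hk], ?_, fun c hc => ?_⟩
  · have hS := continuous_sphereSum_right (d := d) A
    have hw := continuous_comp_of_nonneg (continuousOn_add_rpow (pow_pos he 2) (q - 1))
          (hS.norm.pow 2) (fun x => sq_nonneg _)
    have hi : ∀ k, Integrable (fun x : Fin n → UnitSphere d => A k * (q *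
        (‖sphereSum A x‖ ^ 2 + e ^ 2) ^ (q - 1) *
        (2 * inner ℝ (sphereSum A x) (x k : EuclideanSpace ℝ (Fin d))))) (sphereProd n d) :=
      fun k => integrable_sphereProd (continuous_const.mul ((continuous_const.mul hw).mul
        (continuous_const.mul (hS.inner (by fun_prop)))))
    have e1 : ∀ I : Fin n → ℝ, ∑ k, A k * (σ * I k) / (2 * q) =
        σ * (2 * q)⁻¹ * ∑ k, A k * I k := fun I => by
      rw [Finset.mul_sum]; exact Finset.sum_congr rfl fun k _ => by ring
    rw [e1]
    simp only [← integral_const_mul]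
    rw [← integral_finsetSum _ fun k _ => hi k, mul_assoc, ← integral_const_mul,
      ← integral_const_mul]
    refine integral_congr_ae (Eventually.of_forall fun x => ?_)
    simp only
    -- Euler's relation, applied inside the integral.
    have e2 : ‖sphereSum A x‖ ^ 2 =
        ∑ k, A k * inner ℝ (sphereSum A x) (x k : EuclideanSpace ℝ (Fin d)) := by
      rw [← inner_sphereSum, real_inner_self_eq_norm_sq]
    generalize (‖sphereSum A x‖ ^ 2 + e ^ 2) ^ (q - 1) = w
    rw [e2]
    simp only [Finset.mul_sum]
    refine Finset.sum_congr rfl fun k _ => ?_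
    field_simp
  · obtain ⟨m, hm⟩ : ∃ m : Fin n → ℝ, ∀ k, m k = A k * (σ * ∫ x, q *
      (‖sphereSum A x‖ ^ 2 + e ^ 2) ^ (q - 1) *
      (2 * inner ℝ (sphereSum A x) (x k : EuclideanSpace ℝ (Fin d))) ∂sphereProd n d) / (2 * q) :=
      ⟨_, fun _ => rfl⟩
    simp only [← hm]
    have hle : ∀ δ, 0 < δ →
        σ * ∫ x, (‖sphereSum (fun k => A k * max (c k) δ) x‖ ^ 2 + (δ * e) ^ 2) ^ q
          ∂sphereProd n d ≤
        σ * ∫ x, (‖sphereSum (fun k => A k * δ) x‖ ^ 2 + (δ * e) ^ 2) ^ q ∂sphereProd n d +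
        ∑ k, m k * (max (c k) δ ^ (2 * q) - δ ^ (2 * q)) := fun δ hδ => by
      simp only [hm]
      exact integral_rpow_le_of_le hd hq hσ hA he hδ hA0 (fun k => le_max_right _ _)
    obtain ⟨F, hF⟩ : ∃ F : ℝ → (Fin n → ℝ) → ℝ, ∀ e a,
        F e a = ∫ x, (‖sphereSum a x‖ ^ 2 + e ^ 2) ^ q ∂sphereProd n d := ⟨_, fun _ _ => rfl⟩
    have hFc : Continuous fun p : ℝ × (Fin n → ℝ) => F p.1 p.2 := by
      simp only [hF]
      exact continuous_integral_sphereSum_rpow hq.le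
    simp only [← hF] at hle
    have hp : Continuous fun δ : ℝ => (δ * e, fun k => A k * max (c k) δ) := by fun_prop
    have hp' : Continuous fun δ : ℝ => (δ * e, fun k : Fin n => A k * δ) := by fun_prop
    have h1 : Continuous fun δ : ℝ => σ * F (δ * e) (fun k => A k * max (c k) δ) :=
      continuous_const.mul (hFc.comp hp)
    have h2 : Continuous fun δ : ℝ => σ * F (δ * e) (fun k => A k * δ) +
        ∑ k, m k * (max (c k) δ ^ (2 * q) - δ ^ (2 * q)) :=
      (continuous_const.mul (hFc.comp hp')).add
        (continuous_finsetSum _ fun k _ => continuous_const.mul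
          (((by fun_prop : Continuous fun δ : ℝ => max (c k) δ).rpow_const
            fun _ => Or.inr (by positivity)).sub
            (continuous_id.rpow_const fun _ => Or.inr (by positivity))))
    -- As δ → 0 the smoothing δe disappears from the left side and the starting point of the path
    -- contributes nothing, while the weights m keep the fixed parameter e.
    have hlim := le_of_tendsto_of_tendsto ((h1.tendsto 0).mono_left nhdsWithin_le_nhds)
      ((h2.tendsto 0).mono_left nhdsWithin_le_nhds)
      (Filter.eventually_of_mem (self_mem_nhdsWithin : Set.Ioi (0 : ℝ) ∈ 𝓝[>] 0) hle)
    have hz : ∀ x : Fin n → UnitSphere d, sphereSum (fun _ => (0 : ℝ)) x = 0 := fun x => by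
      simp [sphereSum]
    simpa [hF, max_eq_left (hc _), hz, Real.zero_rpow hq.ne',
      Real.zero_rpow (mul_pos two_pos hq).ne'] using hlim

/-- Removal of the smoothing parameter. -/
theorem tendsto_integral_smoothing {q : ℝ} (hq : 0 < q) (A : Fin n → ℝ) :
    Tendsto (fun e : ℝ => ∫ x, (‖sphereSum A x‖ ^ 2 + e ^ 2) ^ (q - 1) * ‖sphereSum A x‖ ^ 2
        ∂sphereProd n d) (𝓝[>] 0) (𝓝 (∫ x, (‖sphereSum A x‖ ^ 2) ^ q ∂sphereProd n d)) := by
  have hS := continuous_sphereSum_right (d := d) A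
  refine tendsto_integral_filter_of_dominated_convergence
    (fun x => (‖sphereSum A x‖ ^ 2 + 1) ^ q) ?_ ?_ ?_ ?_
  · filter_upwards [self_mem_nhdsWithin] with e he
    have hw := continuous_comp_of_nonneg (continuousOn_add_rpow (pow_pos he 2) (q - 1))
          (hS.norm.pow 2) (fun x => sq_nonneg _)
    exact (hw.mul (hS.norm.pow 2)).aestronglyMeasurable
  · filter_upwards [Ioo_mem_nhdsGT (zero_lt_one' ℝ)] with e he
    refine Eventually.of_forall fun x => ?_
    have he0 := he.1
    rw [Real.norm_of_nonneg (by positivity)]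
    have he2 : 0 < e ^ 2 := by positivity
    have hw : 0 < ‖sphereSum A x‖ ^ 2 + e ^ 2 := by positivity
    calc _ ≤ (‖sphereSum A x‖ ^ 2 + e ^ 2) ^ (q - 1) * (‖sphereSum A x‖ ^ 2 + e ^ 2) := by
          gcongr; linarith
      _ = (‖sphereSum A x‖ ^ 2 + e ^ 2) ^ q := by
          rw [← Real.rpow_add_one hw.ne', sub_add_cancel]
      _ ≤ _ := by
          gcongr
          nlinarith [he.1, he.2]
  · exact integrable_sphereProd (((hS.norm.pow 2).add continuous_const).rpow_const
      fun _ => Or.inr hq.le)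
  · refine Eventually.of_forall fun x => ?_
    -- Where the sum vanishes, the factor |S|² makes the integrand zero for every e, even if q < 1;
    -- elsewhere it is continuous at e = 0.
    rcases (sq_nonneg ‖sphereSum A x‖).eq_or_lt with h | h
    · simp [← h, Real.zero_rpow hq.ne']
    · have h1 : ContinuousAt (fun e : ℝ => (‖sphereSum A x‖ ^ 2 + e ^ 2) ^ (q - 1) *
          ‖sphereSum A x‖ ^ 2) 0 := by
        refine ContinuousAt.mul (ContinuousAt.rpow_const (by fun_prop) (Or.inl ?_))
          continuousAt_const
        simpa using h.ne'
      have h2 := h1.tendsto.mono_left (nhdsWithin_le_nhds (s := Set.Ioi 0))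
      have e1 : (‖sphereSum A x‖ ^ 2 + 0 ^ 2) ^ (q - 1) * ‖sphereSum A x‖ ^ 2 =
          (‖sphereSum A x‖ ^ 2) ^ q := by
        rw [zero_pow two_ne_zero, add_zero, ← Real.rpow_add_one h.ne', sub_add_cancel]
      rwa [e1] at h2

end TangentBound

/-! ### The Jensen-type inequality over a measure space. -/

section Jensen

open Filter Topology

variable {n d : ℕ}

theorem norm_sphereSum_le (a : Fin n → ℝ) (x : Fin n → UnitSphere d) :
    ‖sphereSum a x‖ ≤ ∑ k, |a k| := by
  refine (norm_sum_le _ _).trans (Finset.sum_le_sum fun k _ => ?_)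
  simp [norm_smul]

theorem continuous_integral_norm_sphereSum_rpow {p : ℝ} (hp : 0 ≤ p) :
    Continuous fun a : Fin n → ℝ => ∫ x, ‖sphereSum a x‖ ^ p ∂sphereProd n d := by
  have h : Continuous fun q : (Fin n → ℝ) × (Fin n → UnitSphere d) => ‖sphereSum q.1 q.2‖ ^ p :=
    continuous_sphereSum.norm.rpow_const fun _ => Or.inr hp
  simpa using continuous_parametric_integral_of_continuous (μ := sphereProd n d)
    (f := fun (a : Fin n → ℝ) (x : Fin n → UnitSphere d) => ‖sphereSum a x‖ ^ p) h isCompact_univ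

/-- The law of each z_k is invariant under z ↦ -z, so negative coefficients can be flipped
independently. -/
theorem integral_norm_sphereSum_abs {p : ℝ} (hp : 0 ≤ p) (a : Fin n → ℝ) :
    ∫ x, ‖sphereSum (fun k => |a k|) x‖ ^ p ∂sphereProd n d =
      ∫ x, ‖sphereSum a x‖ ^ p ∂sphereProd n d := by
  have h : Continuous fun x : Fin n → UnitSphere d => ‖sphereSum a x‖ ^ p :=
    (continuous_sphereSum_right a).norm.rpow_const fun _ => Or.inr hp
  rw [← integral_comp_sphereMap (fun k => if a k < 0 then LinearIsometryEquiv.neg ℝ else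
    LinearIsometryEquiv.refl ℝ _) h]
  refine integral_congr_ae (Eventually.of_forall fun x => ?_)
  simp only [sphereSum, coe_sphereMap]
  congr 2
  refine Finset.sum_congr rfl fun k _ => ?_
  split_ifs with hk
  · simp [abs_of_neg hk]
  · simp [abs_of_nonneg (not_lt.1 hk)]

theorem sq_rpow_half {y : ℝ} (hy : 0 ≤ y) (p : ℝ) : (y ^ 2) ^ (p / 2) = y ^ p := by
  rw [← Real.rpow_natCast, ← Real.rpow_mul hy]
  congr 1
  push_cast
  ring

theorem integral_norm_sphereSum_le (hd : 1 ≤ d) {p : ℝ} (hp : 0 ≤ p) (a : Fin n → ℝ) :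
    ∫ x, ‖sphereSum a x‖ ^ p ∂sphereProd n d ≤ (∑ k, |a k|) ^ p := by
  have := isProbabilityMeasure_sphereProd n hd
  calc _ ≤ ∫ _, (∑ k, |a k|) ^ p ∂sphereProd n d := by
        refine integral_mono (integrable_sphereProd
          ((continuous_sphereSum_right a).norm.rpow_const fun _ => Or.inr hp))
          (integrable_const _) fun x => ?_
        exact Real.rpow_le_rpow (norm_nonneg _) (norm_sphereSum_le a x) hp
    _ = _ := by simp

variable {T : Type*} [MeasurableSpace T] {ν : Measure T} {f : Fin n → T → ℝ} {p : ℝ}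

theorem integrable_sum_abs_rpow (hp : 1 ≤ p) (hf : ∀ k, MemLp (f k) (ENNReal.ofReal p) ν) :
    Integrable (fun t => (∑ k, |f k t|) ^ p) ν := by
  have hp0 : 0 < p := by linarith
  have h : MemLp (fun t => ∑ k, |f k t|) (ENNReal.ofReal p) ν :=
    memLp_finsetSum _ fun k _ => (hf k).abs
  have h1 := h.integrable_norm_rpow (by simpa using hp0) ENNReal.ofReal_ne_top
  rw [ENNReal.toReal_ofReal hp0.le] at h1
  refine h1.congr (Eventually.of_forall fun t => ?_)
  simp only
  rw [Real.norm_of_nonneg (Finset.sum_nonneg fun k _ => abs_nonneg _)]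

theorem integrable_integral_norm_sphereSum (hd : 1 ≤ d) (hp : 1 ≤ p)
    (hf : ∀ k, MemLp (f k) (ENNReal.ofReal p) ν) :
    Integrable (fun t => ∫ x, ‖sphereSum (fun k => f k t) x‖ ^ p ∂sphereProd n d) ν := by
  have hp0 : 0 ≤ p := by linarith
  refine (integrable_sum_abs_rpow hp hf).mono' ?_ (Eventually.of_forall fun t => ?_)
  · have hm : AEMeasurable (fun t k => f k t) ν :=
      aemeasurable_pi_lambda _ fun k => (hf k).aestronglyMeasurable.aemeasurable
    exact ((continuous_integral_norm_sphereSum_rpow hp0).measurable.comp_aemeasurable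
      hm).aestronglyMeasurable
  · rw [Real.norm_of_nonneg (integral_nonneg fun x => by positivity)]
    exact integral_norm_sphereSum_le hd hp0 _

/-- The Jensen-type inequality behind the theorem. Here `N k` is the `L_p` norm of `f k`, and the
sign `σ` selects the direction of the inequality. -/
theorem integral_integral_norm_sphereSum_le (hd : 2 ≤ d) (hp : 1 ≤ p) {σ : ℝ}
    (hσ : 0 ≤ σ * (p - 2)) (hA : 0 ≤ p + d - 4) (hf : ∀ k, MemLp (f k) (ENNReal.ofReal p) ν)
    {N : Fin n → ℝ} (hN0 : ∀ k, 0 ≤ N k) (hN : ∀ k, N k ^ p = ∫ t, |f k t| ^ p ∂ν) :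
    σ * ∫ t, ∫ x, ‖sphereSum (fun k => f k t) x‖ ^ p ∂sphereProd n d ∂ν ≤
      σ * ∫ x, ‖sphereSum N x‖ ^ p ∂sphereProd n d := by
  have hp0 : 0 < p := by linarith
  have hfi : ∀ k, Integrable (fun t => |f k t| ^ p) ν := fun k => by
    have h1 := (hf k).integrable_norm_rpow (by simpa using hp0) ENNReal.ofReal_ne_top
    simpa only [ENNReal.toReal_ofReal hp0.le, Real.norm_eq_abs] using h1
  have hzero : ∀ᵐ t ∂ν, ∀ k, N k = 0 → f k t = 0 := by
    refine ae_all_iff.2 fun k => ?_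
    by_cases hk : N k = 0
    · have h := hN k
      rw [hk, Real.zero_rpow hp0.ne', eq_comm,
        integral_eq_zero_iff_of_nonneg (fun t => by positivity) (hfi k)] at h
      filter_upwards [h] with t ht _
      exact abs_eq_zero.1 ((Real.rpow_eq_zero (abs_nonneg _) hp0.ne').1 ht)
    · exact Eventually.of_forall fun t h => absurd h hk
  have hsmooth : ∀ e : ℝ, 0 < e →
      σ * ∫ t, ∫ x, ‖sphereSum (fun k => f k t) x‖ ^ p ∂sphereProd n d ∂ν ≤
      σ * ∫ x, (‖sphereSum N x‖ ^ 2 + e ^ 2) ^ (p / 2 - 1) * ‖sphereSum N x‖ ^ 2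
        ∂sphereProd n d := fun e he => by
    obtain ⟨m, hm0, hms, hm⟩ := exists_tangent_bound (d := d) hd (q := p / 2) (σ := σ)
      (by positivity) (by linarith) (by linarith) he hN0
    rw [← hms, ← integral_const_mul]
    have hi : ∀ k, Integrable (fun t => m k * (|f k t| / N k) ^ p) ν := fun k => by
      simp only [Real.div_rpow (abs_nonneg _) (hN0 k)]
      exact ((hfi k).div_const _).const_mul _
    calc _ ≤ ∫ t, ∑ k, m k * (|f k t| / N k) ^ p ∂ν := by
          refine integral_mono_ae ((integrable_integral_norm_sphereSum (by omega) hp hf).const_mul _)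
            (integrable_finsetSum _ fun k _ => hi k) ?_
          filter_upwards [hzero] with t ht
          -- If N k = 0 the quotient is 0 by convention, which is consistent since f k t = 0 for
          -- almost every t.
          have h := hm (fun k => |f k t| / N k) fun k => div_nonneg (abs_nonneg _) (hN0 k)
          have e1 : (fun k => N k * (|f k t| / N k)) = fun k => |f k t| := by
            ext k
            by_cases hk : N k = 0
            · simp [hk, ht k hk]
            · field_simp
          rw [e1] at h
          simp only [sq_rpow_half (norm_nonneg _), mul_div_cancel₀ p two_ne_zero] at h
          rw [integral_norm_sphereSum_abs hp0.le] at h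
          exact h
      -- Each (|f_k|/N_k)^p has integral 1, except when N_k = 0, and then m_k = 0.
      _ = ∑ k, m k := by
          rw [integral_finsetSum _ fun k _ => hi k]
          refine Finset.sum_congr rfl fun k _ => ?_
          by_cases hk : N k = 0
          · simp [hm0 k hk]
          · have hk' : 0 < N k := lt_of_le_of_ne (hN0 k) (Ne.symm hk)
            rw [integral_const_mul]
            simp only [Real.div_rpow (abs_nonneg _) (hN0 k)]
            rw [integral_div, ← hN, div_self (Real.rpow_pos_of_pos hk' p).ne', mul_one]
  have hlim := (tendsto_integral_smoothing (d := d) (q := p / 2) (by positivity) N).const_mul σ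
  simp only [sq_rpow_half (norm_nonneg _)] at hlim
  exact ge_of_tendsto hlim (Filter.eventually_of_mem self_mem_nhdsWithin hsmooth)

end Jensen

/-! ### Transfer to the random vectors ξ_k. -/

section RandomVectors

variable {Ω : Type*} [MeasurableSpace Ω] {P : Measure Ω} {d : ℕ}
  {ξ : ℕ → Ω → EuclideanSpace ℝ (Fin d)}

theorem uniformSphere_eq_map (d : ℕ) :
    uniformSphere d = (sphereMeasure d).map Subtype.val := rfl

theorem ae_norm_eq_one (hlaw : ∀ k, HasLaw (ξ k) (uniformSphere d) P) (k : ℕ) :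
    ∀ᵐ ω ∂P, ‖ξ k ω‖ = 1 := by
  refine ae_of_ae_map (hlaw k).aemeasurable (p := fun y => ‖y‖ = 1) ?_
  rw [(hlaw k).map_eq, uniformSphere_eq_map, ae_map_iff measurable_subtype_coe.aemeasurable
    (measurableSet_eq_fun measurable_norm measurable_const)]
  exact Filter.Eventually.of_forall fun z => by simp

theorem map_eq_map_sphereProd (hlaw : ∀ k, HasLaw (ξ k) (uniformSphere d) P)
    (hindep : iIndepFun ξ P) (n : ℕ) :
    P.map (fun ω (k : Fin n) => ξ k ω) =
      (sphereProd n d).map fun x k => (x k : EuclideanSpace ℝ (Fin d)) := by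
  have h : iIndepFun (fun k : Fin n => ξ k) P := hindep.precomp Fin.val_injective
  rw [iIndepFun.map_fun_eq_pi_map (f := fun k : Fin n => ξ k) (fun k => (hlaw k).aemeasurable) h,
    sphereProd,
    Measure.pi_map_pi fun _ => measurable_subtype_coe.aemeasurable]
  congr 1
  ext1 k
  exact (hlaw k).map_eq

theorem integral_norm_sum_rpow (hlaw : ∀ k, HasLaw (ξ k) (uniformSphere d) P)
    (hindep : iIndepFun ξ P) {n : ℕ} {p : ℝ} (hp : 0 ≤ p) (a : Fin n → ℝ) :
    ∫ ω, ‖∑ k : Fin n, a k • ξ k ω‖ ^ p ∂P = ∫ x, ‖sphereSum a x‖ ^ p ∂sphereProd n d := by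
  have hG : Continuous fun y : Fin n → EuclideanSpace ℝ (Fin d) => ‖∑ k, a k • y k‖ ^ p :=
    (by fun_prop : Continuous fun y : Fin n → EuclideanSpace ℝ (Fin d) =>
      ‖∑ k, a k • y k‖).rpow_const fun _ => Or.inr hp
  have hm : AEMeasurable (fun ω (k : Fin n) => ξ k ω) P :=
    aemeasurable_pi_lambda _ fun k => (hlaw k).aemeasurable
  have hv : Measurable fun (x : Fin n → UnitSphere d) k => (x k : EuclideanSpace ℝ (Fin d)) :=
    measurable_pi_lambda _ fun k => measurable_subtype_coe.comp (measurable_pi_apply k)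
  have h1 := integral_map hm hG.aestronglyMeasurable
  rw [map_eq_map_sphereProd hlaw hindep, integral_map hv.aemeasurable hG.aestronglyMeasurable] at h1
  exact h1.symm

theorem ae_norm_sum_le (hlaw : ∀ k, HasLaw (ξ k) (uniformSphere d) P) (n : ℕ) :
    ∀ᵐ ω ∂P, ∀ a : Fin n → ℝ, ‖∑ k : Fin n, a k • ξ k ω‖ ≤ ∑ k, |a k| := by
  filter_upwards [ae_all_iff.2 (ae_norm_eq_one hlaw)] with ω hω a
  refine (norm_sum_le _ _).trans (Finset.sum_le_sum fun k _ => ?_)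
  rw [norm_smul, hω, mul_one, Real.norm_eq_abs]

theorem integrable_norm_sum_rpow [IsProbabilityMeasure P] (hlaw : ∀ k, HasLaw (ξ k) (uniformSphere d) P)
    {n : ℕ} {p : ℝ} (hp : 0 ≤ p) (a : Fin n → ℝ) :
    Integrable (fun ω => ‖∑ k : Fin n, a k • ξ k ω‖ ^ p) P := by
  refine Integrable.mono' (integrable_const ((∑ k, |a k|) ^ p)) ?_ ?_
  · have : AEMeasurable (fun ω => ∑ k : Fin n, a k • ξ k ω) P :=
      Finset.aemeasurable_fun_sum _ fun k _ => (hlaw k).aemeasurable.const_smul (a k)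
    exact (this.norm.pow_const p).aestronglyMeasurable
  · filter_upwards [ae_norm_sum_le hlaw n] with ω hω
    rw [Real.norm_of_nonneg (by positivity)]
    exact Real.rpow_le_rpow (norm_nonneg _) (hω a) hp

/-- Almost surely |ξ_k| = 1 for all k, so (∑ |f_k(t)|)^p dominates and depends on t alone. This is
the integrability that Fubini needs. -/
theorem integrable_prod_norm_sum_rpow [IsProbabilityMeasure P] (hlaw : ∀ k, HasLaw (ξ k) (uniformSphere d) P)
    {T : Type*} [MeasurableSpace T] {ν : Measure T} [SFinite ν] {n : ℕ} {f : Fin n → T → ℝ}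
    {p : ℝ} (hp : 1 ≤ p) (hf : ∀ k, MemLp (f k) (ENNReal.ofReal p) ν) :
    Integrable (fun z : Ω × T => ‖∑ k : Fin n, f k z.2 • ξ k z.1‖ ^ p) (P.prod ν) := by
  have hb : Integrable (fun z : Ω × T => (∑ k, |f k z.2|) ^ p) (P.prod ν) :=
    (integrable_sum_abs_rpow hp hf).comp_snd P
  refine hb.mono' ?_ ?_
  · have : AEMeasurable (fun z : Ω × T => ∑ k : Fin n, f k z.2 • ξ k z.1) (P.prod ν) :=
      Finset.aemeasurable_fun_sum _ fun k _ =>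
        (hf k).aestronglyMeasurable.aemeasurable.comp_snd.smul (hlaw k).aemeasurable.comp_fst
    exact (this.norm.pow_const p).aestronglyMeasurable
  · filter_upwards [Measure.quasiMeasurePreserving_fst.ae (ae_norm_sum_le hlaw n)] with z hz
    rw [Real.norm_of_nonneg (by positivity)]
    exact Real.rpow_le_rpow (norm_nonneg _) (hz _) (by linarith)

theorem normLp_rpow {E : Type*} [NormedAddCommGroup E] {p : ℝ} (hp : 0 < p) (F : ℝ → E) :
    normLp p F ^ p = ∫ t in Set.Icc (0 : ℝ) 1, ‖F t‖ ^ p := by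
  rw [normLp, ← Real.rpow_mul (integral_nonneg fun t => by positivity), one_div_mul_cancel hp.ne',
    Real.rpow_one]

theorem expectation_sumFunPow_le [IsProbabilityMeasure P] (hd : 2 ≤ d) (hlaw : ∀ k, HasLaw (ξ k) (uniformSphere d) P)
    (hindep : iIndepFun ξ P) {n : ℕ} {f : Fin n → ℝ → ℝ} {p : ℝ} (hp : 1 ≤ p) {σ : ℝ}
    (hσ : 0 ≤ σ * (p - 2)) (hA : 0 ≤ p + d - 4) (hf : ∀ k, InLp p (f k)) :
    (∀ ω, InLp p (fun t => ∑ k : Fin n, f k t • ξ k ω)) ∧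
      Integrable (sumFunPow ξ p f) P ∧ Integrable (sumNormPow ξ p f) P ∧
      σ * ∫ ω, sumFunPow ξ p f ω ∂P ≤ σ * ∫ ω, sumNormPow ξ p f ω ∂P := by
  have hp0 : 0 < p := by linarith
  have hfun : sumFunPow ξ p f =
      fun ω => ∫ t in Set.Icc (0 : ℝ) 1, ‖∑ k : Fin n, f k t • ξ k ω‖ ^ p :=
    funext fun ω => normLp_rpow hp0 _
  have hprod := integrable_prod_norm_sum_rpow hlaw hp hf
  refine ⟨fun ω => memLp_finsetSum _ fun k _ => ?_, ?_, integrable_norm_sum_rpow hlaw hp0.le _, ?_⟩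
  · have h := (ContinuousLinearMap.toSpanSingleton ℝ (ξ k ω)).comp_memLp' (hf k)
    exact h
  · rw [hfun]
    exact hprod.integral_prod_left
  · rw [hfun, integral_integral_swap hprod]
    simp only [sumNormPow]
    rw [integral_norm_sum_rpow hlaw hindep hp0.le (fun k => normLp p (f k))]
    simp only [fun t => integral_norm_sum_rpow hlaw hindep hp0.le (fun k : Fin n => f k t)]
    refine integral_integral_norm_sphereSum_le hd hp hσ hA hf (fun k => ?_) fun k => ?_
    · exact Real.rpow_nonneg (integral_nonneg fun t => by positivity) _
    · exact normLp_rpow hp0 _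

end RandomVectors

/-! ### The two ranges of p. -/

theorem theorem1 {Ω : Type*} [MeasurableSpace Ω] (P : Measure Ω) [IsProbabilityMeasure P]
    (d : ℕ) (hd : 2 ≤ d) (ξ : ℕ → Ω → EuclideanSpace ℝ (Fin d))
    (hlaw : ∀ k, HasLaw (ξ k) (uniformSphere d) P) (hindep : iIndepFun ξ P) :
    (∀ p : ℝ, 2 ≤ p → ∀ n : ℕ, 1 ≤ n → ∀ f : Fin n → ℝ → ℝ, (∀ k, InLp p (f k)) →
      (∀ ω, InLp p (fun t => ∑ k : Fin n, f k t • ξ k ω)) ∧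
      Integrable (sumFunPow ξ p f) P ∧ Integrable (sumNormPow ξ p f) P ∧
      ∫ ω, sumFunPow ξ p f ω ∂P ≤ ∫ ω, sumNormPow ξ p f ω ∂P) ∧
    (3 ≤ d → ∀ p : ℝ, 1 ≤ p → p ≤ 2 → ∀ n : ℕ, 1 ≤ n → ∀ f : Fin n → ℝ → ℝ,
      (∀ k, InLp p (f k)) →
      (∀ ω, InLp p (fun t => ∑ k : Fin n, f k t • ξ k ω)) ∧
      Integrable (sumFunPow ξ p f) P ∧ Integrable (sumNormPow ξ p f) P ∧
      ∫ ω, sumNormPow ξ p f ω ∂P ≤ ∫ ω, sumFunPow ξ p f ω ∂P) := by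
  refine ⟨fun p hp n _ f hf => ?_, fun hd3 p hp1 hp2 n _ f hf => ?_⟩
  · have hd' : (2 : ℝ) ≤ d := by exact_mod_cast hd
    -- Here p ≥ 2 and d ≥ 2 give p + d ≥ 4.
    obtain ⟨h1, h2, h3, h4⟩ := expectation_sumFunPow_le hd hlaw hindep (p := p) (σ := 1)
      (by linarith) (by linarith) (by linarith) hf
    exact ⟨h1, h2, h3, by linarith⟩
  · have hd' : (3 : ℝ) ≤ d := by exact_mod_cast hd3
    -- Here p ≥ 1 and d ≥ 3 give p + d ≥ 4, and σ = -1 reverses the inequality.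
    obtain ⟨h1, h2, h3, h4⟩ := expectation_sumFunPow_le hd hlaw hindep (p := p) (σ := -1)
      hp1 (by linarith) (by linarith) hf
    exact ⟨h1, h2, h3, by linarith⟩
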